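/- Let $q,\xi\in[0,1)$. For a partition $\lambda=(\lambda_1\ge\lambda_2\ge\cdots)$ (with $\lambda_i=0$ for large $i$) write $|\lambda|=\sum_i\lambda_i$, $b(\lambda)=\sum_{i\ge1}(i-1)\lambda_i$, and let $h(i,j)=\lambda_i+\lambda^{\mathrm T}_j-i-j+1$ be the hook length of a cell $(i,j)$ of $\lambda$, where $\lambda^{\mathrm T}$ is the transposed partition. Let $M(\xi;q)=\prod_{n\ge1}(1-\xi^2q^n)^{-n}$. The squared-type and the mixed-type $q$-Plancherel measures on the set of all partitions are (with $0^0=1$) $$\mu_S[\lambda]=M(\xi;q)^{-1}\,(\xi^2q)^{|\lambda|}\,q^{2b(\lambda)}\prod_{(i,j)\in\lambda}\frac1{(1-q^{h(i,j)})^2},$$ $$\mu_M[\lambda]=\exp\!\Big(-\frac{\xi^2}{1-q}\Big)\,\xi^{2|\lambda|}\,q^{b(\lambda)}\prod_{(i,j)\in\lambda}\frac1{h(i,j)\,(1-q^{h(i,j)})}.$$ Both are probability measures. Moreover, for each of the two measures $\mu$, the random point configuration $\Xi(\lambda)=\{\lambda_i-i+\tfrac12 : i\ge1\}\subset\mathbb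 Z+\tfrac12$, with $\lambda$ distributed according to $\mu$, is a discrete determinantal point process on $\mathbb Z+\tfrac12$: there is a kernel $K:(\mathbb Z+\tfrac12)^2\to\mathbb C$ such that for every $k\ge0$ and all distinct $z_1,\dots,z_k\in\mathbb Z+\tfrac12$, $$\mu\big[\{z_1,\dots,z_k\}\subset\Xi(\lambda)\big]=\det_{1\le i,j\le k}K(z_i,z_j).$$ -/

import Mathlib

open MeasureTheory

noncomputable section

/-! Partitions are Young diagrams, with rows and columns indexed from `0`:
`lam.rowLen i` is the part of index `i + 1`, `lam.colLen j` the part of index `j + 1` of the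
transposed partition, and `lam.card` is the size. -/

/-- `b(λ) = ∑_{i ≥ 1} (i - 1) λ_i`. -/
def bStat (lam : YoungDiagram) : ℕ :=
  ∑ i ∈ Finset.range (lam.colLen 0), i * lam.rowLen i

/-- The hook length of the cell `c = (i, j)` (indices from `0`). On cells of `lam` the
subtractions do not truncate. -/
def hookLength (lam : YoungDiagram) (c : ℕ × ℕ) : ℕ :=
  lam.rowLen c.1 + lam.colLen c.2 - c.1 - c.2 - 1

/-- The modified MacMahon function `M(ξ; q) = ∏_{n ≥ 1} (1 - ξ² qⁿ)⁻ⁿ`. -/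
def modMacMahon (ξ q : ℝ) : ℝ :=
  ∏' n : ℕ, 1 / (1 - ξ ^ 2 * q ^ (n + 1)) ^ (n + 1)

/-- The mass of `lam` under the squared type `q`-Plancherel measure. -/
def squaredWeight (ξ q : ℝ) (lam : YoungDiagram) : ℝ :=
  (modMacMahon ξ q)⁻¹ * (ξ ^ 2 * q) ^ lam.card * q ^ (2 * bStat lam) *
    ∏ c ∈ lam.cells, 1 / (1 - q ^ hookLength lam c) ^ 2

/-- The mass of `lam` under the mixed type `q`-Plancherel measure. -/
def mixedWeight (ξ q : ℝ) (lam : YoungDiagram) : ℝ :=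
  Real.exp (-(ξ ^ 2 / (1 - q))) * ξ ^ (2 * lam.card) * q ^ bStat lam *
    ∏ c ∈ lam.cells, 1 / ((hookLength lam c : ℝ) * (1 - q ^ hookLength lam c))

/-- Every set of partitions is measurable. -/
instance : MeasurableSpace YoungDiagram := ⊤

/-- The measure on partitions with the given (nonnegative) point masses. -/
def partitionMeasure (w : YoungDiagram → ℝ) : Measure YoungDiagram :=
  Measure.sum fun lam => ENNReal.ofReal (w lam) • Measure.dirac lam

/-- The squared type `q`-Plancherel measure. -/
def squaredQPlancherel (ξ q : ℝ) : Measure YoungDiagram :=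
  partitionMeasure (squaredWeight ξ q)

/-- The mixed type `q`-Plancherel measure. -/
def mixedQPlancherel (ξ q : ℝ) : Measure YoungDiagram :=
  partitionMeasure (mixedWeight ξ q)

/-- The lattice `ℤ + 1/2`. -/
abbrev HalfInt : Type := {x : ℚ // ∃ n : ℤ, x = (n : ℚ) + 1 / 2}

/-- The point configuration `{λ_i - i + 1/2 : i ≥ 1}` of a partition, a subset of `ℤ + 1/2`
(with `i` replaced by `i + 1`, as rows are indexed from `0`). -/
def configuration (lam : YoungDiagram) : Set HalfInt :=
  {x | ∃ i : ℕ, (x : ℚ) = (lam.rowLen i : ℚ) - ((i : ℚ) + 1) + 1 / 2}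

/-- The law of the random point configuration `configuration lam`, with `lam` distributed
according to `μ`; sets of configurations carry the product (cylinder) `σ`-algebra. -/
def configurationLaw (μ : Measure YoungDiagram) : Measure (Set HalfInt) :=
  μ.map configuration

/-- The correlation function `ρ(Z) = P(Z ⊆ S)` of a random subset `S` with law `P`. -/
def correlationFunction {E : Type*} (P : Measure (Set E)) (Z : Finset E) : ℝ :=
  P.real {S : Set E | (Z : Set E) ⊆ S}

/-- A (simple) point process on a discrete space `E`, given by its law `P` on subsets of `E`, is
determinantal if there is one kernel `K` on `E × E` such that, for every `k` and all distinct
points `z_1, …, z_k`, the `k`-point correlation function is the determinant of the matrix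
`K(z_i, z_j)`. -/
def IsDiscreteDeterminantal {E : Type*} (P : Measure (Set E)) : Prop :=
  IsProbabilityMeasure P ∧
    ∃ K : E → E → ℂ, ∀ (k : ℕ) (z : Fin k ↪ E),
      ((correlationFunction P (Finset.univ.map z) : ℝ) : ℂ) =
        (Matrix.of fun i j : Fin k => K (z i) (z j)).det

end

/-!
Both measures are Schur measures: by the hook length formula for principal specializations, the
weight of `λ` is a constant times a product `s_λ(ρ) s_λ(ρ')`, with two principal specializations
(squared type) or a principal and a Plancherel one (mixed type). The Cauchy identity, passed to the
limit from finitely many variables `1, q, …, q ^ (N - 1)`, gives the normalizing constants.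

By Jacobi–Trudi, `s_λ(ρ)` is a minor of a matrix whose rows are selected by the particles of `λ`.
Restricted to the partitions in a finite box, a Schur measure is therefore a biorthogonal ensemble,
and the Cauchy–Binet formula makes its correlations minors of `U (V U)⁻¹ V`. Bordering `V` and `Wᵀ`
by basis vectors, Cauchy–Binet and the inequality of arithmetic and geometric means bound the
entries of `Wᵀ (V Wᵀ)⁻¹ V` by the Gram determinants of `V` and `W`, which stay bounded over all
boxes when the specialized Schur functions are square summable. A limit of the kernels along an
ultrafilter is then a kernel for the whole measure.
-/

noncomputable section

open Filter Topology Finset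
open scoped Matrix

theorem sum_tuples_eq_sum_orderEmbedding {m M : Type*} [Fintype m] [LinearOrder m]
    [AddCommMonoid M] {N : ℕ} (F : (Fin N → m) → M)
    (hF : ∀ s, ¬ Function.Injective s → F s = 0) :
    ∑ s, F s = ∑ s : Fin N ↪o m, ∑ σ : Equiv.Perm (Fin N), F (s ∘ σ) := by
  rw [← Fintype.sum_prod_type' fun (s : Fin N ↪o m) (σ : Equiv.Perm (Fin N)) => F (s ∘ σ)]
  symm
  refine Finset.sum_of_injOn (fun p : (Fin N ↪o m) × Equiv.Perm (Fin N) => p.1 ∘ p.2) ?_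
    (fun _ _ => mem_coe.2 (mem_univ _)) ?_ fun _ _ => rfl
  · rintro ⟨s, σ⟩ - ⟨t, τ⟩ - (hst : s ∘ σ = t ∘ τ)
    have hrange : Set.range s = Set.range t := by
      rw [← σ.surjective.range_comp s, hst, τ.surjective.range_comp t]
    obtain rfl : s = t :=
      DFunLike.coe_injective ((s.strictMono.range_inj t.strictMono).1 hrange)
    exact Prod.ext rfl (Equiv.ext fun i => s.injective (congrFun hst i))
  · intro s _ hs
    refine hF s fun hinj => hs ⟨(OrderEmbedding.ofStrictMono (s ∘ Tuple.sort s)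
      ((Tuple.monotone_sort s).strictMono_of_injective (hinj.comp (Tuple.sort s).injective)),
      (Tuple.sort s)⁻¹), mem_coe.2 (mem_univ _), ?_⟩
    ext i
    simp

section Determinants

variable {R : Type*} [CommRing R]

theorem det_mul_eq_sum_tuples {n m : Type*} [Fintype n] [DecidableEq n] [Fintype m]
    (V : Matrix n m R) (U : Matrix m n R) :
    (V * U).det = ∑ s : n → m, (∏ i, V i (s i)) * (U.submatrix s id).det := by
  classical
  have hrows : V * U = fun i => ∑ l, V i l • U l := by
    ext i j
    simp [Matrix.mul_apply]
  rw [hrows]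
  exact (Matrix.detRowAlternating.toMultilinearMap.map_sum _).trans
    (sum_congr rfl fun s _ => Matrix.detRowAlternating.toMultilinearMap.map_smul_univ _ _)

theorem det_mul_eq_sum_orderEmbedding {m : Type*} [Fintype m] [LinearOrder m] {N : ℕ}
    (V : Matrix (Fin N) m R) (U : Matrix m (Fin N) R) :
    (V * U).det = ∑ s : Fin N ↪o m, (V.submatrix id s).det * (U.submatrix s id).det := by
  rw [det_mul_eq_sum_tuples, sum_tuples_eq_sum_orderEmbedding]
  · refine sum_congr rfl fun s _ => ?_
    rw [← Matrix.det_transpose, Matrix.det_apply', sum_mul]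
    refine sum_congr rfl fun σ _ => ?_
    have hperm : (U.submatrix (s ∘ σ) id).det = Equiv.Perm.sign σ * (U.submatrix s id).det :=
      Matrix.det_permute σ (U.submatrix s id)
    rw [hperm]
    simp only [Matrix.transpose_apply, Matrix.submatrix_apply, Function.comp_apply, id]
    ring
  · intro s hs
    obtain ⟨i, j, hij, hne⟩ : ∃ i j, s i = s j ∧ i ≠ j := by
      simpa [Function.Injective] using hs
    rw [Matrix.det_zero_of_row_eq hne (by ext; simp [hij]), mul_zero]

theorem det_transpose_submatrix {m n k : Type*} [Fintype k] [DecidableEq k] (A : Matrix m n R)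
    (e : k → m) (f : k → n) : (Aᵀ.submatrix f e).det = (A.submatrix e f).det :=
  Matrix.det_transpose (A.submatrix e f)

theorem det_mul_transpose_eq_sum_sq {m : Type*} [Fintype m] [LinearOrder m] {N : ℕ}
    (V : Matrix (Fin N) m R) :
    (V * Vᵀ).det = ∑ s : Fin N ↪o m, (V.submatrix id s).det ^ 2 := by
  simp only [det_mul_eq_sum_orderEmbedding, det_transpose_submatrix, sq]

theorem det_mul_diagonal_mul_eq_sum_orderEmbedding {m : Type*} [Fintype m] [LinearOrder m] {N : ℕ}
    (V : Matrix (Fin N) m R) (w : m → R) (U : Matrix m (Fin N) R) :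
    (V * Matrix.diagonal w * U).det =
      ∑ s : Fin N ↪o m, (V.submatrix id s).det * (U.submatrix s id).det * ∏ i, w (s i) := by
  rw [det_mul_eq_sum_orderEmbedding]
  refine sum_congr rfl fun s _ => ?_
  have hsub : (V * Matrix.diagonal w).submatrix id s =
      V.submatrix id s * Matrix.diagonal (w ∘ s) := by
    ext i j
    simp
  rw [hsub, Matrix.det_mul, Matrix.det_diagonal]
  simp only [Function.comp_apply]
  ring

end Determinants

section BiorthogonalEnsembles

variable {R : Type*} [CommRing R]

/-- The correlation kernel of the biorthogonal ensemble on `m` with weights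
`s ↦ det (V_s) * det (U_s)`, where `V_s` and `U_s` are the square submatrices indexed by the
points of `s`. -/
def biorthogonalKernel {n m : Type*} [Fintype n] [DecidableEq n] [Fintype m] (V : Matrix n m R)
    (U : Matrix m n R) : Matrix m m R :=
  U * (V * U)⁻¹ * V

theorem mul_diagonal_ite_mul {n m κ : Type*} [Fintype m] [DecidableEq m] [Fintype κ]
    (V : Matrix n m R) (U : Matrix m n R) (z : κ ↪ m) (c : R) :
    V * Matrix.diagonal (fun l => if l ∈ univ.map z then 1 + c else 1) * U =
      V * U + (c • V.submatrix id z) * U.submatrix z id := by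
  ext i j
  have hw : ∀ l, V i l * (if l ∈ univ.map z then 1 + c else 1) * U l j =
      V i l * U l j + if l ∈ univ.map z then c * V i l * U l j else 0 := fun l => by
    split_ifs <;> ring
  rw [Matrix.mul_apply]
  simp only [Matrix.mul_diagonal, hw, sum_add_distrib, sum_ite_mem, univ_inter, sum_map]
  rfl

theorem det_mul_diagonal_ite_mul {n m κ : Type*} [Fintype n] [DecidableEq n] [Fintype m]
    [DecidableEq m] [Fintype κ] [DecidableEq κ] {V : Matrix n m R} {U : Matrix m n R}
    (hdet : IsUnit (V * U).det) (z : κ ↪ m) (c : R) :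
    (V * Matrix.diagonal (fun l => if l ∈ univ.map z then 1 + c else 1) * U).det =
      (V * U).det * (1 + c • (biorthogonalKernel V U).submatrix z z).det := by
  rw [mul_diagonal_ite_mul, Matrix.det_add_mul _ _ hdet, Matrix.mul_smul]
  rfl

theorem prod_ite_mem_map {m κ M : Type*} [DecidableEq m] [Fintype κ] [CommMonoid M] {N : ℕ}
    (s : Fin N ↪ m) (z : κ ↪ m) (x : M) :
    ∏ i, (if s i ∈ univ.map z then x else 1) = x ^ #(univ.map s ∩ univ.map z) := by
  rw [← prod_map univ s (fun l => if l ∈ univ.map z then x else 1), prod_ite_mem, prod_const]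

theorem card_map_inter_map_eq_card_iff {m κ : Type*} [DecidableEq m] [Fintype κ] {N : ℕ}
    (s : Fin N ↪ m) (z : κ ↪ m) :
    Fintype.card κ = #(univ.map s ∩ univ.map z) ↔ univ.map z ⊆ univ.map s := by
  rw [← card_univ, ← card_map z]
  exact ⟨fun h => inter_eq_right.1 (eq_of_subset_of_card_le inter_subset_right h.le),
    fun h => by rw [inter_eq_right.2 h]⟩

theorem biorthogonalKernel_map {n m S : Type*} [Fintype n] [DecidableEq n] [Fintype m] [CommRing S]
    (f : R →+* S) {V : Matrix n m R} {U : Matrix m n R} (hdet : IsUnit (V * U).det) :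
    biorthogonalKernel (V.map f) (U.map f) = (biorthogonalKernel V U).map f := by
  have hinv : (V.map f * U.map f)⁻¹ = ((V * U)⁻¹).map f :=
    Matrix.inv_eq_right_inv (by
      rw [← Matrix.map_mul, ← Matrix.map_mul, Matrix.mul_nonsing_inv _ hdet,
        Matrix.map_one f (map_zero f) (map_one f)])
  simp only [biorthogonalKernel, hinv, Matrix.map_mul]

open Polynomial in
theorem coeff_det_one_add_X_sub_one_smul {κ : Type*} [Fintype κ] [DecidableEq κ]
    (K : Matrix κ κ R) :
    (1 + (X - 1 : R[X]) • K.map C).det.coeff (Fintype.card κ) = K.det := by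
  have hsplit : 1 + (X - 1 : R[X]) • K.map C = (X : R[X]) • K.map C + (1 - K).map C := by
    rw [Matrix.map_sub C (map_sub C), Matrix.map_one C C_0 C_1, sub_smul, one_smul]
    abel
  rw [hsplit, coeff_det_X_add_C_card]

open Polynomial in
-- Both sides are the top coefficient of the generating polynomial of the number of points of `s`
-- in the range of `z`.
theorem sum_det_mul_det_of_map_subset {m κ : Type*} [Fintype m] [LinearOrder m] [Fintype κ]
    [DecidableEq κ] {N : ℕ} {V : Matrix (Fin N) m R} {U : Matrix m (Fin N) R}
    (hdet : IsUnit (V * U).det) (z : κ ↪ m) :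
    ∑ s : Fin N ↪o m with univ.map z ⊆ univ.map s.toEmbedding,
        (V.submatrix id s).det * (U.submatrix s id).det =
      (V * U).det * ((biorthogonalKernel V U).submatrix z z).det := by
  have hC : ∀ A : Matrix (Fin N) (Fin N) R, (A.map C).det = C A.det :=
    fun A => (RingHom.map_det C A).symm
  have hdetC : (V.map C * U.map C : Matrix _ _ R[X]).det = C (V * U).det := by
    rw [← Matrix.map_mul, hC]
  have hexpand := (det_mul_diagonal_mul_eq_sum_orderEmbedding (V.map C) _ (U.map C)).symm.trans
    (det_mul_diagonal_ite_mul (hdetC ▸ hdet.map C) z (X - 1))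
  rw [hdetC, biorthogonalKernel_map C hdet, Matrix.submatrix_map] at hexpand
  have hcoeff := congrArg (coeff · (Fintype.card κ)) hexpand
  simp only [finsetSum_coeff, coeff_C_mul, coeff_det_one_add_X_sub_one_smul] at hcoeff
  rw [← hcoeff, sum_filter]
  refine sum_congr rfl fun s _ => ?_
  have hpow := prod_ite_mem_map s.toEmbedding z (X : R[X])
  simp only [RelEmbedding.coe_toEmbedding] at hpow
  rw [Matrix.submatrix_map, Matrix.submatrix_map, hC, hC, ← C_mul, add_sub_cancel, hpow,
    coeff_C_mul_X_pow]
  simp only [card_map_inter_map_eq_card_iff]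

end BiorthogonalEnsembles

section KernelBound

theorem two_mul_abs_det_mul_transpose_le_of_fin {m : Type*} [Fintype m] [LinearOrder m] {N : ℕ}
    (V W : Matrix (Fin N) m ℝ) : 2 * |(V * Wᵀ).det| ≤ (V * Vᵀ).det + (W * Wᵀ).det := by
  rw [det_mul_transpose_eq_sum_sq, det_mul_transpose_eq_sum_sq, ← sum_add_distrib,
    det_mul_eq_sum_orderEmbedding]
  refine (mul_le_mul_of_nonneg_left (abs_sum_le_sum_abs _ _) zero_le_two).trans ?_
  rw [mul_sum]
  refine sum_le_sum fun s _ => ?_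
  rw [det_transpose_submatrix, abs_mul, ← mul_assoc, ← sq_abs (V.submatrix id s).det,
    ← sq_abs (W.submatrix id s).det]
  exact two_mul_le_add_sq _ _

theorem two_mul_abs_det_mul_transpose_le {n m : Type*} [Fintype n] [DecidableEq n] [Fintype m]
    [LinearOrder m] (V W : Matrix n m ℝ) :
    2 * |(V * Wᵀ).det| ≤ (V * Vᵀ).det + (W * Wᵀ).det := by
  let e := (Fintype.equivFin n).symm
  have hreindex : ∀ A B : Matrix n m ℝ,
      (A * Bᵀ).det = (A.submatrix e id * (B.submatrix e id)ᵀ).det := fun A B => by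
    rw [← Matrix.det_submatrix_equiv_self e, ← Matrix.submatrix_mul_equiv A Bᵀ e (Equiv.refl m) e]
    rfl
  simp only [hreindex]
  exact two_mul_abs_det_mul_transpose_le_of_fin _ _

theorem isUnit_det_mul_transpose {m : Type*} [Fintype m] [LinearOrder m] {N : ℕ}
    {V W : Matrix (Fin N) m ℝ} (hdet : (V * Wᵀ).det ≠ 0) : IsUnit (V * Vᵀ).det := by
  rw [isUnit_iff_ne_zero]
  contrapose! hdet
  rw [det_mul_transpose_eq_sum_sq, sum_eq_zero_iff_of_nonneg fun _ _ => sq_nonneg _] at hdet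
  rw [det_mul_eq_sum_orderEmbedding]
  exact sum_eq_zero fun s hs => by rw [pow_eq_zero_iff two_ne_zero |>.1 (hdet s hs), zero_mul]

/-- The matrix `V` with the standard basis vector `e_a` as an additional row. -/
def addBasisRow {R n m : Type*} [CommRing R] [DecidableEq m] (V : Matrix n m R) (a : m) :
    Matrix (n ⊕ Unit) m R :=
  Matrix.fromRows V ((1 : Matrix m m R).submatrix (fun _ : Unit => a) id)

theorem det_addBasisRow_mul_transpose {R n m : Type*} [CommRing R] [Fintype n] [DecidableEq n]
    [Fintype m] [DecidableEq m] {V W : Matrix n m R} (hdet : IsUnit (V * Wᵀ).det) (a b : m) :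
    (addBasisRow V a * (addBasisRow W b)ᵀ).det =
      (V * Wᵀ).det * ((1 : Matrix m m R) a b - biorthogonalKernel V Wᵀ a b) := by
  let _ := Matrix.invertibleOfIsUnitDet _ hdet
  rw [addBasisRow, addBasisRow, Matrix.transpose_fromRows, Matrix.fromRows_mul_fromCols,
    Matrix.det_fromBlocks₁₁, Matrix.invOf_eq_nonsing_inv, Matrix.det_unique (n := Unit)]
  simp [biorthogonalKernel, Matrix.mul_apply, Matrix.one_apply, eq_comm]

theorem det_mul_biorthogonalKernel_nonneg {m : Type*} [Fintype m] [LinearOrder m] {N : ℕ}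
    {V : Matrix (Fin N) m ℝ} (hdet : IsUnit (V * Vᵀ).det) (a : m) :
    0 ≤ (V * Vᵀ).det * biorthogonalKernel V Vᵀ a a := by
  have hsum : _ = (V * Vᵀ).det * biorthogonalKernel V Vᵀ a a :=
    (sum_det_mul_det_of_map_subset hdet (Function.Embedding.punit.{_, 1} a)).trans
      (congrArg _ (Matrix.det_unique _))
  rw [← hsum]
  exact sum_nonneg fun s _ => by
    rw [det_transpose_submatrix]
    exact mul_self_nonneg _

theorem det_addBasisRow_mul_transpose_self_le {m : Type*} [Fintype m] [LinearOrder m] {N : ℕ}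
    {V : Matrix (Fin N) m ℝ} (hdet : IsUnit (V * Vᵀ).det) (a : m) :
    (addBasisRow V a * (addBasisRow V a)ᵀ).det ≤ (V * Vᵀ).det := by
  rw [det_addBasisRow_mul_transpose hdet, Matrix.one_apply_eq, mul_sub, mul_one]
  exact sub_le_self _ (det_mul_biorthogonalKernel_nonneg hdet a)

theorem abs_biorthogonalKernel_le {m : Type*} [Fintype m] [LinearOrder m] {N : ℕ}
    {V W : Matrix (Fin N) m ℝ} (hdet : (V * Wᵀ).det ≠ 0) (a b : m) :
    |biorthogonalKernel V Wᵀ a b| ≤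
      1 + ((V * Vᵀ).det + (W * Wᵀ).det) / (2 * |(V * Wᵀ).det|) := by
  have hW : (W * Vᵀ).det ≠ 0 := by
    rwa [← Matrix.det_transpose, Matrix.transpose_mul, Matrix.transpose_transpose]
  have hbordered := (two_mul_abs_det_mul_transpose_le (addBasisRow V a) (addBasisRow W b)).trans <|
    add_le_add (det_addBasisRow_mul_transpose_self_le (isUnit_det_mul_transpose hdet) a)
      (det_addBasisRow_mul_transpose_self_le (isUnit_det_mul_transpose hW) b)
  rw [det_addBasisRow_mul_transpose (isUnit_iff_ne_zero.2 hdet), abs_mul] at hbordered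
  have hcomplement : |(1 : Matrix m m ℝ) a b - biorthogonalKernel V Wᵀ a b| ≤
      ((V * Vᵀ).det + (W * Wᵀ).det) / (2 * |(V * Wᵀ).det|) := by
    rw [le_div_iff₀ (mul_pos two_pos (abs_pos.2 hdet))]
    linarith
  have hone : |(1 : Matrix m m ℝ) a b| ≤ 1 := by
    rw [Matrix.one_apply]
    split_ifs <;> simp
  calc |biorthogonalKernel V Wᵀ a b|
      = |(1 : Matrix m m ℝ) a b - ((1 : Matrix m m ℝ) a b - biorthogonalKernel V Wᵀ a b)| := by
        rw [sub_sub_cancel]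
    _ ≤ _ := (abs_sub _ _).trans (add_le_add hone hcomplement)

end KernelBound

section Particles

theorem rowLen_eq_zero_iff {lam : YoungDiagram} {i : ℕ} :
    lam.rowLen i = 0 ↔ lam.colLen 0 ≤ i := by
  rw [← not_lt, ← YoungDiagram.mem_iff_lt_colLen, YoungDiagram.mem_iff_lt_rowLen, not_lt,
    Nat.le_zero]

theorem rowLen_injective : Function.Injective YoungDiagram.rowLen := by
  intro lam mu h
  ext ⟨i, j⟩
  rw [YoungDiagram.mem_cells, YoungDiagram.mem_cells, YoungDiagram.mem_iff_lt_rowLen,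
    YoungDiagram.mem_iff_lt_rowLen, h]

/-- The positions of the first `N` particles `λ_i - i` of the partition `λ`, listed increasingly and
shifted by `N` to make them natural numbers when `λ` has at most `N` rows. -/
def particlePos (N : ℕ) (lam : YoungDiagram) (a : Fin N) : ℕ :=
  lam.rowLen a.rev + a

theorem particlePos_strictMono (N : ℕ) (lam : YoungDiagram) : StrictMono (particlePos N lam) :=
  fun _ _ hab => add_lt_add_of_le_of_lt
    (lam.rowLen_anti _ _ (Fin.val_fin_le.2 (Fin.rev_anti hab.le))) hab

theorem particlePos_injOn (N : ℕ) :
    Set.InjOn (particlePos N) {lam : YoungDiagram | lam.colLen 0 ≤ N} := by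
  intro lam hlam mu hmu h
  refine rowLen_injective (funext fun i => ?_)
  rcases lt_or_ge i N with hi | hi
  · have := congrFun h (Fin.rev ⟨i, hi⟩)
    simpa only [particlePos, Fin.rev_rev, add_left_inj] using this
  · rw [rowLen_eq_zero_iff.2 (hlam.trans hi), rowLen_eq_zero_iff.2 (hmu.trans hi)]

theorem add_sub_le_of_strictMono {N : ℕ} {s : Fin N → ℕ} (hs : StrictMono s) {a b : Fin N}
    (hab : a ≤ b) : s a + (b - a) ≤ s b := by
  have hcard : #(Ico a b) ≤ #(Ico (s a) (s b)) :=
    card_le_card_of_injOn s (fun i hi => by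
      rw [mem_coe, mem_Ico] at hi ⊢
      exact ⟨hs.monotone hi.1, hs hi.2⟩) hs.injective.injOn
  rw [Fin.card_Ico, Nat.card_Ico] at hcard
  have := hs.monotone hab
  omega

theorem exists_particlePos_eq {N : ℕ} {s : Fin N → ℕ} (hs : StrictMono s) :
    ∃ lam : YoungDiagram, lam.colLen 0 ≤ N ∧ particlePos N lam = s := by
  let row : Fin N → ℕ := fun i => s i.rev - i.rev
  have hanti : Antitone row := fun i j hij => by
    have := add_sub_le_of_strictMono hs (Fin.rev_anti hij)
    simp only [row]
    omega
  let lam := YoungDiagram.ofRowLens (List.ofFn row) hanti.sortedGE_ofFn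
  have hrow : ∀ i : Fin N, lam.rowLen i = row i := fun i => by
    simpa using YoungDiagram.rowLen_ofRowLens (w := List.ofFn row) (hw := hanti.sortedGE_ofFn)
      (i.cast List.length_ofFn.symm)
  refine ⟨lam, ?_, funext fun a => ?_⟩
  · refine rowLen_eq_zero_iff.1 (Nat.le_zero.1 (not_lt.1 fun h => ?_))
    obtain ⟨hlt, -⟩ := YoungDiagram.mem_ofRowLens.1 (YoungDiagram.mem_iff_lt_rowLen.2 h)
    simp at hlt
  · have hzero : (⟨0, a.pos⟩ : Fin N) ≤ a := Nat.zero_le _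
    have : s ⟨0, a.pos⟩ + (a - 0) ≤ s a := add_sub_le_of_strictMono hs hzero
    simp only [particlePos, hrow, row, Fin.rev_rev]
    omega

theorem finite_setOf_colLen_rowLen_le (N L : ℕ) :
    {lam : YoungDiagram | lam.colLen 0 ≤ N ∧ lam.rowLen 0 + N ≤ L}.Finite := by
  have hinj : Function.Injective YoungDiagram.cells := fun _ _ h => YoungDiagram.ext h
  refine ((range N ×ˢ range L).powerset.finite_toSet.preimage hinj.injOn).subset ?_
  rintro lam ⟨hcol, hrow⟩
  simp only [Set.mem_preimage, mem_coe, mem_powerset]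
  rintro ⟨i, j⟩ hc
  rw [YoungDiagram.mem_cells] at hc
  have hi := YoungDiagram.mem_iff_lt_colLen.1 (lam.up_left_mem le_rfl (Nat.zero_le j) hc)
  have hj := YoungDiagram.mem_iff_lt_rowLen.1 (lam.up_left_mem (Nat.zero_le i) le_rfl hc)
  simp only [mem_product, mem_range]
  omega

/-- The partitions with at most `N` rows and at most `L - N` columns (none if `L < N`), that is,
those with at most `N` rows whose first `N` shifted particles lie in `{0, …, L - 1}`. -/
def partitionBox (N L : ℕ) : Finset YoungDiagram :=
  (finite_setOf_colLen_rowLen_le N L).toFinset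

theorem mem_partitionBox {N L : ℕ} {lam : YoungDiagram} :
    lam ∈ partitionBox N L ↔ lam.colLen 0 ≤ N ∧ lam.rowLen 0 + N ≤ L := by
  simp [partitionBox]

theorem particlePos_lt_of_mem_partitionBox {N L : ℕ} {lam : YoungDiagram}
    (h : lam ∈ partitionBox N L) (a : Fin N) : particlePos N lam a < L := by
  have := (mem_partitionBox.1 h).2
  have := lam.rowLen_anti 0 a.rev (Nat.zero_le _)
  have := a.isLt
  simp only [particlePos]
  omega

theorem mem_partitionBox_of_particlePos_lt {N L : ℕ} {lam : YoungDiagram}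
    (hcol : lam.colLen 0 ≤ N) (hpos : ∀ a, particlePos N lam a < L) : lam ∈ partitionBox N L := by
  refine mem_partitionBox.2 ⟨hcol, ?_⟩
  rcases N.eq_zero_or_pos with rfl | hN
  · rw [rowLen_eq_zero_iff.2 hcol]
    exact Nat.zero_le _
  · have := hpos (Fin.rev ⟨0, hN⟩)
    simp only [particlePos, Fin.rev_rev, Fin.val_rev] at this
    omega

theorem sum_partitionBox_eq_sum_orderEmbedding {M : Type*} [AddCommMonoid M] (N L : ℕ)
    (F : (Fin N → ℕ) → M) :
    ∑ lam ∈ partitionBox N L, F (particlePos N lam) = ∑ s : Fin N ↪o Fin L, F fun a => s a := by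
  refine sum_bij (fun lam hlam => OrderEmbedding.ofStrictMono
      (fun a => (⟨particlePos N lam a, particlePos_lt_of_mem_partitionBox hlam a⟩ : Fin L))
      fun _ _ hab => particlePos_strictMono N lam hab)
    (fun _ _ => mem_univ _) ?_ ?_ fun _ _ => rfl
  · intro lam hlam mu hmu h
    refine particlePos_injOn N (mem_partitionBox.1 hlam).1 (mem_partitionBox.1 hmu).1
      (funext fun a => ?_)
    exact congrArg Fin.val (DFunLike.congr_fun h a)
  · intro s _
    obtain ⟨lam, hcol, hpos⟩ :=
      exists_particlePos_eq (s := fun a => (s a : ℕ)) fun _ _ hab => s.strictMono hab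
    have hmem : lam ∈ partitionBox N L :=
      mem_partitionBox_of_particlePos_lt hcol fun a => hpos ▸ (s a).isLt
    exact ⟨lam, hmem, DFunLike.ext _ _ fun a => Fin.ext (congrFun hpos a)⟩

end Particles

section Configurations

/-- The index in `ℕ` of the site `z` of `ℤ + 1/2` when particle positions are shifted by `N`, as in
`particlePos`; sites with `⌊z⌋ < -N` have no index and are sent to `0`. -/
def sitePos (N : ℕ) (z : HalfInt) : ℕ :=
  (⌊(z : ℚ)⌋ + N).toNat

theorem floor_halfInt_add_half (z : HalfInt) : (⌊(z : ℚ)⌋ : ℚ) + 1 / 2 = z := by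
  obtain ⟨_, n, rfl⟩ := z
  have hfloor : ⌊(1 / 2 : ℚ)⌋ = 0 := by norm_num
  rw [Int.floor_intCast_add, hfloor, add_zero]

theorem sitePos_injOn (N : ℕ) : Set.InjOn (sitePos N) {z | -⌊(z : ℚ)⌋ ≤ N} := by
  intro z hz w hw h
  simp only [Set.mem_ofPred_eq] at hz hw
  have hfloor : ⌊(z : ℚ)⌋ = ⌊(w : ℚ)⌋ := by
    simp only [sitePos] at h
    omega
  rw [Subtype.ext_iff, ← floor_halfInt_add_half z, hfloor, floor_halfInt_add_half]

theorem mem_configuration_iff_floor {z : HalfInt} {lam : YoungDiagram} :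
    z ∈ configuration lam ↔ ∃ i : ℕ, ⌊(z : ℚ)⌋ = (lam.rowLen i : ℤ) - (i + 1) := by
  refine exists_congr fun i => ?_
  have hz := floor_halfInt_add_half z
  rw [← Int.cast_inj (α := ℚ)]
  push_cast
  constructor <;> intro h <;> linarith

theorem mem_configuration_iff {N : ℕ} {z : HalfInt} {lam : YoungDiagram}
    (hcol : lam.colLen 0 ≤ N) (hz : -⌊(z : ℚ)⌋ ≤ N) :
    z ∈ configuration lam ↔ sitePos N z ∈ Set.range (particlePos N lam) := by
  rw [mem_configuration_iff_floor]
  constructor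
  · rintro ⟨i, hi⟩
    have hiN : i < N := by
      by_contra! hNi
      rw [rowLen_eq_zero_iff.2 (hcol.trans hNi)] at hi
      omega
    refine ⟨Fin.rev ⟨i, hiN⟩, ?_⟩
    simp only [particlePos, sitePos, Fin.rev_rev, Fin.val_rev]
    omega
  · rintro ⟨a, ha⟩
    refine ⟨a.rev, ?_⟩
    simp only [particlePos, sitePos] at ha
    have := Fin.val_rev a
    omega

end Configurations

section HookLengths

/-- The position, in the numbering of `particlePos`, of the `j`-th hole of the particle
configuration of a partition with at most `N` rows. -/
def holePos (N : ℕ) (lam : YoungDiagram) (j : ℕ) : ℕ :=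
  N + j - lam.colLen j

theorem colLen_le_of_colLen_zero_le {N : ℕ} {lam : YoungDiagram} (hcol : lam.colLen 0 ≤ N) (j : ℕ) :
    lam.colLen j ≤ N :=
  (lam.colLen_anti 0 j (Nat.zero_le j)).trans hcol

theorem holePos_strictMono {N : ℕ} {lam : YoungDiagram} (hcol : lam.colLen 0 ≤ N) :
    StrictMono (holePos N lam) := by
  intro j k hjk
  have := colLen_le_of_colLen_zero_le hcol j
  have := lam.colLen_anti j k hjk.le
  simp only [holePos]
  omega

theorem holePos_lt_particlePos {N : ℕ} {lam : YoungDiagram} {a : Fin N} {j : ℕ}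
    (hj : j < lam.rowLen a.rev) : holePos N lam j < particlePos N lam a := by
  have := YoungDiagram.mem_iff_lt_colLen.1 (YoungDiagram.mem_iff_lt_rowLen.2 hj)
  have := Fin.val_rev a
  simp only [holePos, particlePos]
  omega

theorem holePos_ne_particlePos {N : ℕ} {lam : YoungDiagram} (hcol : lam.colLen 0 ≤ N) (j : ℕ)
    (a : Fin N) : holePos N lam j ≠ particlePos N lam a := by
  have hmem : a.rev < lam.colLen j ↔ j < lam.rowLen a.rev := by
    rw [← YoungDiagram.mem_iff_lt_colLen, YoungDiagram.mem_iff_lt_rowLen]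
  have := colLen_le_of_colLen_zero_le hcol j
  have := Fin.val_rev a
  simp only [holePos, particlePos]
  omega

theorem hookLength_eq_sub {N : ℕ} {lam : YoungDiagram} (hcol : lam.colLen 0 ≤ N) (a : Fin N)
    (j : ℕ) : hookLength lam (a.rev, j) = particlePos N lam a - holePos N lam j := by
  have := colLen_le_of_colLen_zero_le hcol j
  have := Fin.val_rev a
  simp only [hookLength, holePos, particlePos]
  omega

theorem prod_holePos_mul_prod_particlePos {M : Type*} [CommMonoid M] {N : ℕ} {lam : YoungDiagram}
    (hcol : lam.colLen 0 ≤ N) (f : ℕ → M) (a : Fin N) :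
    (∏ j ∈ range (lam.rowLen a.rev), f (holePos N lam j)) *
        ∏ b ∈ Iio a, f (particlePos N lam b) =
      ∏ m ∈ range (particlePos N lam a), f m := by
  have hholes := (holePos_strictMono hcol).injective
  have hparticles := (particlePos_strictMono N lam).injective
  have hdisj : Disjoint ((range (lam.rowLen a.rev)).image (holePos N lam))
      ((Iio a).image (particlePos N lam)) := by
    simp only [disjoint_left, mem_image, not_exists, not_and]
    rintro _ ⟨j, -, rfl⟩ b -
    exact (holePos_ne_particlePos hcol j b).symm
  have hunion : (range (lam.rowLen a.rev)).image (holePos N lam) ∪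
      (Iio a).image (particlePos N lam) = range (particlePos N lam a) := by
    refine eq_of_subset_of_card_le (union_subset ?_ ?_) ?_
    · exact image_subset_iff.2 fun j hj =>
        mem_range.2 (holePos_lt_particlePos (mem_range.1 hj))
    · exact image_subset_iff.2 fun b hb =>
        mem_range.2 (particlePos_strictMono N lam (mem_Iio.1 hb))
    · rw [card_union_of_disjoint hdisj, card_image_of_injective _ hholes,
        card_image_of_injective _ hparticles, card_range, card_range, Fin.card_Iio, particlePos]
  rw [← hunion, prod_union hdisj, prod_image hholes.injOn, prod_image hparticles.injOn]

-- The hook lengths of the row of the particle `a` are its distances to the holes below it.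
theorem prod_row_hookLength_mul_prod_sub {M : Type*} [CommMonoid M] {N : ℕ} {lam : YoungDiagram}
    (hcol : lam.colLen 0 ≤ N) (f : ℕ → M) (a : Fin N) :
    (∏ j ∈ range (lam.rowLen a.rev), f (hookLength lam (a.rev, j))) *
        ∏ b ∈ Iio a, f (particlePos N lam a - particlePos N lam b) =
      ∏ m ∈ range (particlePos N lam a), f (m + 1) := by
  simp only [hookLength_eq_sub hcol]
  rw [prod_holePos_mul_prod_particlePos hcol (fun m => f (particlePos N lam a - m)),
    ← prod_range_reflect]
  refine prod_congr rfl fun m hm => congrArg f ?_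
  have := mem_range.1 hm
  omega

theorem hookLength_pos {lam : YoungDiagram} {c : ℕ × ℕ} (hc : c ∈ lam.cells) :
    0 < hookLength lam c := by
  rw [YoungDiagram.mem_cells] at hc
  have := YoungDiagram.mem_iff_lt_rowLen.1 hc
  have := YoungDiagram.mem_iff_lt_colLen.1 hc
  simp only [hookLength]
  omega

@[to_additive]
theorem prod_cells_eq {M : Type*} [CommMonoid M] {N : ℕ} {lam : YoungDiagram}
    (hcol : lam.colLen 0 ≤ N) (f : ℕ × ℕ → M) :
    ∏ c ∈ lam.cells, f c = ∏ a : Fin N, ∏ j ∈ range (lam.rowLen a.rev), f (a.rev, j) := by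
  rw [prod_finset_product lam.cells (range N) fun i => range (lam.rowLen i), prod_range]
  · exact (Equiv.prod_comp Fin.revPerm
      fun i : Fin N => ∏ j ∈ range (lam.rowLen i), f (i, j)).symm
  · rintro ⟨i, j⟩
    simp only [YoungDiagram.mem_cells, mem_range, YoungDiagram.mem_iff_lt_rowLen,
      iff_and_self]
    intro hj
    by_contra! hi
    simp [rowLen_eq_zero_iff.2 (hcol.trans hi)] at hj

theorem card_add_sum_eq_sum_particlePos {N : ℕ} {lam : YoungDiagram} (hcol : lam.colLen 0 ≤ N) :
    lam.card + ∑ a : Fin N, (a : ℕ) = ∑ a, particlePos N lam a := by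
  rw [YoungDiagram.card, card_eq_sum_ones, sum_cells_eq hcol]
  simp only [particlePos, sum_add_distrib, sum_const, card_range, smul_eq_mul, mul_one]

theorem sum_sum_Iio_rowLen_rev {N : ℕ} {lam : YoungDiagram} (hcol : lam.colLen 0 ≤ N) :
    ∑ a : Fin N, ∑ b ∈ Iio a, lam.rowLen b.rev = bStat lam := by
  have hextend : bStat lam = ∑ i ∈ range N, i * lam.rowLen i :=
    sum_subset (range_mono hcol) fun i _ hi => by
      rw [rowLen_eq_zero_iff.2 (not_lt.1 (mt mem_range.2 hi)), mul_zero]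
  calc ∑ a : Fin N, ∑ b ∈ Iio a, lam.rowLen b.rev
      = ∑ b : Fin N, ∑ _a ∈ Ioi b, lam.rowLen b.rev := sum_comm' (by simp)
    _ = ∑ b : Fin N, (b.rev : ℕ) * lam.rowLen b.rev := by
      refine sum_congr rfl fun b _ => ?_
      rw [sum_const, Fin.card_Ioi, smul_eq_mul, Fin.val_rev, Nat.sub_sub, add_comm 1]
    _ = ∑ i : Fin N, (i : ℕ) * lam.rowLen i :=
      Equiv.sum_comp Fin.revPerm fun i : Fin N => (i : ℕ) * lam.rowLen i
    _ = bStat lam := by rw [hextend, sum_range]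

theorem sum_Iio_val {N : ℕ} (a : Fin N) : ∑ b ∈ Iio a, (b : ℕ) = ∑ k ∈ range a, k := by
  rw [← Nat.Iio_eq_range, ← Fin.map_valEmbedding_Iio, sum_map]
  rfl

end HookLengths

section SchurFunctions

variable {R : Type*} [CommRing R]

/-- The matrix `h (l - j)`, with `h` vanishing at negative integers. Its rows at the shifted
positions `λ_i - i + N` form the Jacobi–Trudi matrix of the partition `λ`. -/
def jacobiTrudi (h : ℕ → R) (N : ℕ) : Matrix ℕ (Fin N) R :=
  Matrix.of fun l j => if j ≤ l then h (l - j) else 0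

/-- The value at the partition `lam` of the Schur function, in the specialization of symmetric
functions sending the complete homogeneous functions to `h`; this is the Jacobi–Trudi formula. -/
def schur (h : ℕ → R) (lam : YoungDiagram) : R :=
  ((jacobiTrudi h (lam.colLen 0)).submatrix (particlePos _ lam) id).det

theorem det_jacobiTrudi_succ {h : ℕ → R} (h0 : h 0 = 1) {N : ℕ} {lam : YoungDiagram}
    (hcol : lam.colLen 0 ≤ N) :
    ((jacobiTrudi h (N + 1)).submatrix (particlePos (N + 1) lam) id).det =
      ((jacobiTrudi h N).submatrix (particlePos N lam) id).det := by
  have hfirst : particlePos (N + 1) lam 0 = 0 := by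
    simp [particlePos, rowLen_eq_zero_iff.2 hcol]
  have hsucc : ∀ a : Fin N, particlePos (N + 1) lam a.succ = particlePos N lam a + 1 := fun a => by
    simp [particlePos, Fin.rev_succ, add_assoc]
  rw [Matrix.det_succ_row_zero, Fin.sum_univ_succ, add_eq_left.2 (sum_eq_zero fun j _ => ?_)]
  · simp only [Fin.coe_ofNat_eq_mod, Nat.zero_mod, pow_zero, one_mul, Matrix.submatrix_apply,
      hfirst, id, jacobiTrudi, Matrix.of_apply, le_refl, if_true, h0, Nat.sub_self]
    congr 1
    ext a j
    simp [hsucc]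
  · simp [jacobiTrudi, hfirst]

theorem schur_eq_det {h : ℕ → R} (h0 : h 0 = 1) {N : ℕ} {lam : YoungDiagram}
    (hcol : lam.colLen 0 ≤ N) :
    schur h lam = ((jacobiTrudi h N).submatrix (particlePos N lam) id).det := by
  induction N, hcol using Nat.le_induction with
  | base => rfl
  | succ N hcol ih => rw [ih, det_jacobiTrudi_succ h0 hcol]

theorem colLen_zero_bot : (⊥ : YoungDiagram).colLen 0 = 0 := by
  rw [← Nat.le_zero, ← rowLen_eq_zero_iff]
  simp [YoungDiagram.rowLen_eq_card, YoungDiagram.row]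

theorem schur_bot (h : ℕ → R) : schur h ⊥ = 1 := by
  have : IsEmpty (Fin ((⊥ : YoungDiagram).colLen 0)) := by
    rw [colLen_zero_bot]
    infer_instance
  exact Matrix.det_isEmpty

theorem schur_pow_mul (x : R) (h : ℕ → R) (lam : YoungDiagram) :
    schur (fun n => x ^ n * h n) lam = x ^ lam.card * schur h lam := by
  simp only [schur, Matrix.det_apply, mul_sum, mul_smul_comm]
  refine sum_congr rfl fun σ _ => congrArg _ ?_
  simp only [Matrix.submatrix_apply, jacobiTrudi, Matrix.of_apply, id]
  by_cases hle : ∀ j : Fin _, (j : ℕ) ≤ particlePos _ lam (σ j)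
  · have hcard : ∑ j, (particlePos _ lam (σ j) - (j : ℕ)) = lam.card := by
      have := card_add_sum_eq_sum_particlePos (le_refl (lam.colLen 0))
      rw [sum_tsub_distrib _ fun j _ => hle j, Equiv.sum_comp σ (particlePos _ lam), ← this,
        Nat.add_sub_cancel]
    simp only [hle, if_true, prod_mul_distrib, prod_pow_eq_pow_sum, hcard]
  · push Not at hle
    obtain ⟨j, hj⟩ := hle
    have hj' := not_le.2 hj
    rw [prod_eq_zero (mem_univ j) (if_neg hj'), prod_eq_zero (mem_univ j) (if_neg hj'), mul_zero]

end SchurFunctions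

section BoxSums

/-- The index in `{0, …, L}` of the site `z` of `ℤ + 1/2`, meaningful when `sitePos N z ≤ L`. -/
def siteFin (N L : ℕ) (z : HalfInt) : Fin (L + 1) :=
  Fin.ofNat (L + 1) (sitePos N z)

theorem val_siteFin {N L : ℕ} {z : HalfInt} (hz : sitePos N z ≤ L) :
    (siteFin N L z : ℕ) = sitePos N z :=
  Nat.mod_eq_of_lt (Nat.lt_succ_of_le hz)

variable {R : Type*} [CommRing R] {N : ℕ}

/-- The first `L` rows of a matrix with rows indexed by the natural numbers. -/
def firstRows (L : ℕ) (A : Matrix ℕ (Fin N) R) : Matrix (Fin L) (Fin N) R :=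
  A.submatrix Fin.val id

theorem sum_partitionBox_det_mul_det (L : ℕ) (A B : Matrix ℕ (Fin N) R) :
    ∑ lam ∈ partitionBox N L, (A.submatrix (particlePos N lam) id).det *
        (B.submatrix (particlePos N lam) id).det =
      ((firstRows L A)ᵀ * firstRows L B).det := by
  rw [det_mul_eq_sum_orderEmbedding, sum_partitionBox_eq_sum_orderEmbedding N L
    fun p => (A.submatrix p id).det * (B.submatrix p id).det]
  simp only [det_transpose_submatrix]
  rfl

open Classical in
theorem sum_partitionBox_det_mul_det_of_subset_configuration {κ : Type*} [Fintype κ]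
    [DecidableEq κ] (L : ℕ) (A B : Matrix ℕ (Fin N) R)
    (hdet : IsUnit ((firstRows (L + 1) A)ᵀ * firstRows (L + 1) B).det)
    (z : κ ↪ HalfInt) (hz : ∀ i, -⌊(z i : ℚ)⌋ ≤ N ∧ sitePos N (z i) ≤ L) :
    ∑ lam ∈ partitionBox N (L + 1) with Set.range z ⊆ configuration lam,
        (A.submatrix (particlePos N lam) id).det * (B.submatrix (particlePos N lam) id).det =
      ((firstRows (L + 1) A)ᵀ * firstRows (L + 1) B).det *
        ((biorthogonalKernel (firstRows (L + 1) A)ᵀ (firstRows (L + 1) B)).submatrix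
          (siteFin N L ∘ z) (siteFin N L ∘ z)).det := by
  have hval : ∀ i, (siteFin N L (z i) : ℕ) = sitePos N (z i) := fun i => val_siteFin (hz i).2
  let w : κ ↪ Fin (L + 1) := ⟨siteFin N L ∘ z, fun i j hij => z.injective
    (sitePos_injOn N (hz i).1 (hz j).1 (by rw [← hval, ← hval]; exact congrArg Fin.val hij))⟩
  have hsub : ∀ lam ∈ partitionBox N (L + 1), Set.range z ⊆ configuration lam ↔
      Set.range (sitePos N ∘ z) ⊆ Set.range (particlePos N lam) := by
    intro lam hlam
    simp only [Set.range_subset_iff, Function.comp_apply,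
      mem_configuration_iff (mem_partitionBox.1 hlam).1 (hz _).1]
  rw [sum_filter, sum_congr rfl fun lam hlam => if_congr (hsub lam hlam) rfl rfl,
    sum_partitionBox_eq_sum_orderEmbedding N (L + 1) fun p =>
      if Set.range (sitePos N ∘ z) ⊆ Set.range p then
        (A.submatrix p id).det * (B.submatrix p id).det else 0]
  refine Eq.trans ?_ (sum_det_mul_det_of_map_subset hdet w)
  rw [sum_filter]
  refine sum_congr rfl fun s _ => if_congr ?_ ?_ rfl
  · simp only [Set.range_subset_iff, Function.comp_apply, Set.mem_range, ← hval, subset_iff,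
      Finset.mem_map, mem_univ, true_and, forall_exists_index, forall_apply_eq_imp_iff,
      ← Fin.ext_iff]
    rfl
  · rw [det_transpose_submatrix]
    rfl

end BoxSums

section SchurMeasures

theorem sum_partitionBox_schur_mul_schur {R : Type*} [CommRing R] {h h' : ℕ → R} (h0 : h 0 = 1)
    (h0' : h' 0 = 1) (N L : ℕ) :
    ∑ lam ∈ partitionBox N L, schur h lam * schur h' lam =
      ((firstRows L (jacobiTrudi h N))ᵀ * firstRows L (jacobiTrudi h' N)).det := by
  rw [← sum_partitionBox_det_mul_det]
  refine sum_congr rfl fun lam hlam => ?_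
  rw [schur_eq_det h0 (mem_partitionBox.1 hlam).1, schur_eq_det h0' (mem_partitionBox.1 hlam).1]

/-- The correlation kernel on `ℤ + 1/2` of the Schur measure with weights `schur h * schur h'`
conditioned on the partitions with at most `n` rows and at most `n + 1` columns; it has no meaning
outside the sites which the first `n` particles of such partitions can occupy. -/
def schurKernel (h h' : ℕ → ℝ) (n : ℕ) : Matrix HalfInt HalfInt ℝ :=
  (biorthogonalKernel (firstRows (2 * n + 1) (jacobiTrudi h n))ᵀ
    (firstRows (2 * n + 1) (jacobiTrudi h' n))).submatrix (siteFin n (2 * n)) (siteFin n (2 * n))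

theorem tendsto_partitionBox_atTop :
    Tendsto (fun n : ℕ => partitionBox n (2 * n + 1)) atTop atTop := by
  refine tendsto_atTop_finset_of_monotone (fun m n hmn lam hlam => ?_) fun lam =>
    ⟨lam.colLen 0 + lam.rowLen 0, ?_⟩
  · rw [mem_partitionBox] at hlam ⊢
    omega
  · rw [mem_partitionBox]
    omega

theorem eventually_sitePos_le (z : HalfInt) :
    ∀ᶠ n : ℕ in atTop, -⌊(z : ℚ)⌋ ≤ n ∧ sitePos n z ≤ 2 * n := by
  filter_upwards [eventually_ge_atTop ⌊(z : ℚ)⌋.natAbs] with n hn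
  simp only [sitePos]
  omega

variable {h h' : ℕ → ℝ}

theorem one_le_sum_partitionBox (hnonneg : ∀ lam, 0 ≤ schur h lam * schur h' lam) (n : ℕ) :
    1 ≤ ∑ lam ∈ partitionBox n (2 * n + 1), schur h lam * schur h' lam := by
  have hmem : ⊥ ∈ partitionBox n (2 * n + 1) := by
    rw [mem_partitionBox, colLen_zero_bot, rowLen_eq_zero_iff.2 colLen_zero_bot.le]
    omega
  calc (1 : ℝ) = schur h ⊥ * schur h' ⊥ := by rw [schur_bot, schur_bot, one_mul]
    _ ≤ _ := single_le_sum (fun lam _ => hnonneg lam) hmem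

variable (h0 : h 0 = 1) (h0' : h' 0 = 1) (hnonneg : ∀ lam, 0 ≤ schur h lam * schur h' lam)

include h0 h0' hnonneg

theorem abs_schurKernel_le (hsq : Summable fun lam => schur h lam ^ 2)
    (hsq' : Summable fun lam => schur h' lam ^ 2) (n : ℕ) (a b : HalfInt) :
    |schurKernel h h' n a b| ≤
      1 + (∑' lam, schur h lam ^ 2 + ∑' lam, schur h' lam ^ 2) / 2 := by
  set V := (firstRows (2 * n + 1) (jacobiTrudi h n))ᵀ
  set W := (firstRows (2 * n + 1) (jacobiTrudi h' n))ᵀ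
  have hV : (V * Vᵀ).det ≤ ∑' lam, schur h lam ^ 2 := by
    rw [Matrix.transpose_transpose, ← sum_partitionBox_schur_mul_schur h0 h0]
    simp only [← sq]
    exact hsq.sum_le_tsum _ fun _ _ => sq_nonneg _
  have hW : (W * Wᵀ).det ≤ ∑' lam, schur h' lam ^ 2 := by
    rw [Matrix.transpose_transpose, ← sum_partitionBox_schur_mul_schur h0' h0']
    simp only [← sq]
    exact hsq'.sum_le_tsum _ fun _ _ => sq_nonneg _
  have hone : 1 ≤ (V * Wᵀ).det := by
    rw [Matrix.transpose_transpose, ← sum_partitionBox_schur_mul_schur h0 h0']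
    exact one_le_sum_partitionBox hnonneg n
  refine (abs_biorthogonalKernel_le (zero_lt_one.trans_le hone).ne' _ _).trans ?_
  gcongr
  linarith [le_abs_self (V * Wᵀ).det]

open Classical in
theorem eventually_sum_partitionBox_schur_mul_schur_of_subset_configuration {κ : Type*} [Fintype κ]
    [DecidableEq κ] (z : κ ↪ HalfInt) : ∀ᶠ n : ℕ in atTop,
      ∑ lam ∈ partitionBox n (2 * n + 1) with Set.range z ⊆ configuration lam,
          schur h lam * schur h' lam =
        (∑ lam ∈ partitionBox n (2 * n + 1), schur h lam * schur h' lam) *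
          ((schurKernel h h' n).submatrix z z).det := by
  filter_upwards [eventually_all.2 fun i => eventually_sitePos_le (z i)] with n hn
  have hone := one_le_sum_partitionBox hnonneg n
  rw [sum_partitionBox_schur_mul_schur h0 h0'] at hone ⊢
  refine Eq.trans (sum_congr rfl fun lam hlam => ?_)
    (sum_partitionBox_det_mul_det_of_subset_configuration (2 * n) _ _
      (isUnit_iff_ne_zero.2 (zero_lt_one.trans_le hone).ne') z hn)
  have hcol := (mem_partitionBox.1 (mem_filter.1 hlam).1).1
  rw [schur_eq_det h0 hcol, schur_eq_det h0' hcol]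

-- The kernels of the boxes are uniformly bounded, so they converge along an ultrafilter.
theorem exists_tendsto_schurKernel (hsq : Summable fun lam => schur h lam ^ 2)
    (hsq' : Summable fun lam => schur h' lam ^ 2) :
    ∃ K : Matrix HalfInt HalfInt ℝ,
      Tendsto (schurKernel h h') (hyperfilter ℕ : Filter ℕ) (𝓝 K) := by
  set C := 1 + (∑' lam, schur h lam ^ 2 + ∑' lam, schur h' lam ^ 2) / 2
  have hlim : ∀ a b, ∃ c, Tendsto (fun n => schurKernel h h' n a b) (hyperfilter ℕ : Filter ℕ)
      (𝓝 c) := by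
    intro a b
    obtain ⟨c, -, hc⟩ := (isCompact_Icc (a := -C) (b := C)).ultrafilter_le_nhds
      ((hyperfilter ℕ).map fun n => schurKernel h h' n a b)
      (le_principal_iff.2 (Filter.mem_map.2 (Eventually.of_forall fun n =>
        abs_le.1 (abs_schurKernel_le h0 h0' hnonneg hsq hsq' n a b))))
    exact ⟨c, hc⟩
  choose K hK using hlim
  exact ⟨K, tendsto_pi_nhds.2 fun a => tendsto_pi_nhds.2 fun b => hK a b⟩

open Classical in
theorem exists_hasSum_schur_mul_schur_of_subset_configuration {Z : ℝ}
    (hsum : HasSum (fun lam => schur h lam * schur h' lam) Z)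
    (hsq : Summable fun lam => schur h lam ^ 2) (hsq' : Summable fun lam => schur h' lam ^ 2) :
    ∃ K : Matrix HalfInt HalfInt ℝ, ∀ (k : ℕ) (z : Fin k ↪ HalfInt),
      HasSum (fun lam => if Set.range z ⊆ configuration lam then schur h lam * schur h' lam else 0)
        (Z * (K.submatrix z z).det) := by
  obtain ⟨K, hK⟩ := exists_tendsto_schurKernel h0 h0' hnonneg hsq hsq'
  have hle : (hyperfilter ℕ : Filter ℕ) ≤ atTop :=
    hyperfilter_le_cofinite.trans_eq Nat.cofinite_eq_atTop
  refine ⟨K, fun k z => ?_⟩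
  have hsub : HasSum (fun lam => if Set.range z ⊆ configuration lam then
      schur h lam * schur h' lam else 0) _ :=
    (hsum.summable.indicator {lam | Set.range z ⊆ configuration lam}).hasSum
  have hdet : Continuous fun M : Matrix HalfInt HalfInt ℝ => (M.submatrix z z).det := by fun_prop
  have hlim := ((hsum.comp tendsto_partitionBox_atTop).mono_left hle).mul ((hdet.tendsto K).comp hK)
  rw [← tendsto_nhds_unique_of_eventuallyEq
    ((hsub.comp tendsto_partitionBox_atTop).mono_left hle) hlim ?_]
  · exact hsub
  · filter_upwards [hle (eventually_sum_partitionBox_schur_mul_schur_of_subset_configuration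
      h0 h0' hnonneg z)] with n hn
    exact (sum_filter _ _).symm.trans hn

end SchurMeasures

section PartitionMeasures

open Classical in
theorem partitionMeasure_apply_of_hasSum {w : YoungDiagram → ℝ} (hw : ∀ lam, 0 ≤ w lam)
    {A : Set YoungDiagram} {a : ℝ} (ha : HasSum (fun lam => if lam ∈ A then w lam else 0) a) :
    partitionMeasure w A = ENNReal.ofReal a := by
  have hA : MeasurableSet A := trivial
  have hnonneg : ∀ lam, 0 ≤ if lam ∈ A then w lam else 0 := fun lam => by
    split_ifs
    exacts [hw lam, le_rfl]
  rw [partitionMeasure, Measure.sum_apply _ hA, ← ha.tsum_eq,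
    ENNReal.ofReal_tsum_of_nonneg hnonneg ha.summable]
  refine tsum_congr fun lam => ?_
  by_cases hlam : lam ∈ A <;> simp [Measure.dirac_apply' _ hA, hlam]

theorem isProbabilityMeasure_partitionMeasure {w : YoungDiagram → ℝ} (hw : ∀ lam, 0 ≤ w lam)
    (hsum : HasSum w 1) : IsProbabilityMeasure (partitionMeasure w) := by
  refine ⟨?_⟩
  rw [partitionMeasure_apply_of_hasSum hw (a := 1) (by simpa using hsum), ENNReal.ofReal_one]

theorem measurable_configuration : Measurable configuration := measurable_from_top

theorem measurableSet_setOf_coe_subset {E : Type*} (Z : Finset E) :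
    MeasurableSet {S : Set E | (Z : Set E) ⊆ S} := by
  have hinter : {S : Set E | (Z : Set E) ⊆ S} = ⋂ a ∈ Z, {S : Set E | a ∈ S} := by
    ext S
    simp [Set.subset_def]
  rw [hinter]
  exact Z.measurableSet_biInter fun a _ => measurableSet_setOfPred.2 (measurable_set_mem a)

open Classical in
theorem correlationFunction_configurationLaw_partitionMeasure {w : YoungDiagram → ℝ}
    (hw : ∀ lam, 0 ≤ w lam) (Z : Finset HalfInt) {a : ℝ}
    (ha : HasSum (fun lam => if (Z : Set HalfInt) ⊆ configuration lam then w lam else 0) a) :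
    correlationFunction (configurationLaw (partitionMeasure w)) Z = a := by
  have hnonneg : 0 ≤ a := ha.nonneg fun lam => by
    split_ifs
    exacts [hw lam, le_rfl]
  have hmass : partitionMeasure w {lam | (Z : Set HalfInt) ⊆ configuration lam} =
      ENNReal.ofReal a := partitionMeasure_apply_of_hasSum hw (by simpa only [Set.mem_ofPred_eq])
  rw [correlationFunction, configurationLaw, Measure.real,
    Measure.map_apply measurable_configuration (measurableSet_setOf_coe_subset Z)]
  exact (congrArg ENNReal.toReal hmass).trans (ENNReal.toReal_ofReal hnonneg)

open Classical in
theorem isDiscreteDeterminantal_configurationLaw_partitionMeasure {w : YoungDiagram → ℝ}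
    (hw : ∀ lam, 0 ≤ w lam) (hsum : HasSum w 1) (K : Matrix HalfInt HalfInt ℝ)
    (hK : ∀ (k : ℕ) (z : Fin k ↪ HalfInt), HasSum
      (fun lam => if Set.range z ⊆ configuration lam then w lam else 0) (K.submatrix z z).det) :
    IsDiscreteDeterminantal (configurationLaw (partitionMeasure w)) := by
  have := isProbabilityMeasure_partitionMeasure hw hsum
  refine ⟨Measure.isProbabilityMeasure_map measurable_configuration.aemeasurable,
    fun a b => (K a b : ℂ), fun k z => ?_⟩
  rw [correlationFunction_configurationLaw_partitionMeasure hw (univ.map z)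
    (by simpa only [coe_map, coe_univ, Set.image_univ] using hK k z)]
  exact RingHom.map_det Complex.ofRealHom (K.submatrix z z)

theorem isProbabilityMeasure_and_isDiscreteDeterminantal_schurMeasure {h h' : ℕ → ℝ}
    (h0 : h 0 = 1) (h0' : h' 0 = 1) (hnonneg : ∀ lam, 0 ≤ schur h lam * schur h' lam) {Z : ℝ}
    (hsum : HasSum (fun lam => schur h lam * schur h' lam) Z)
    (hsq : Summable fun lam => schur h lam ^ 2) (hsq' : Summable fun lam => schur h' lam ^ 2) :
    IsProbabilityMeasure (partitionMeasure fun lam => Z⁻¹ * (schur h lam * schur h' lam)) ∧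
      IsDiscreteDeterminantal
        (configurationLaw (partitionMeasure fun lam => Z⁻¹ * (schur h lam * schur h' lam))) := by
  classical
  have hZ : 0 < Z := by
    have := le_hasSum hsum ⊥ fun lam _ => hnonneg lam
    rw [schur_bot, schur_bot, mul_one] at this
    exact zero_lt_one.trans_le this
  have hw : ∀ lam, 0 ≤ Z⁻¹ * (schur h lam * schur h' lam) := fun lam =>
    mul_nonneg (inv_nonneg.2 hZ.le) (hnonneg lam)
  have hone : HasSum (fun lam => Z⁻¹ * (schur h lam * schur h' lam)) 1 := by
    rw [← inv_mul_cancel₀ hZ.ne']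
    exact hsum.mul_left Z⁻¹
  obtain ⟨K, hK⟩ :=
    exists_hasSum_schur_mul_schur_of_subset_configuration h0 h0' hnonneg hsum hsq hsq'
  refine ⟨isProbabilityMeasure_partitionMeasure hw hone,
    isDiscreteDeterminantal_configurationLaw_partitionMeasure hw hone K fun k z => ?_⟩
  have hkz := (hK k z).mul_left Z⁻¹
  rw [inv_mul_cancel_left₀ hZ.ne'] at hkz
  simpa only [mul_ite, mul_zero] using hkz

end PartitionMeasures

section PrincipalSpecialization

/-- The `q`-number `1 + q + ⋯ + q ^ (k - 1)`. -/
def qNum (q : ℝ) (k : ℕ) : ℝ :=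
  ∑ i ∈ range k, q ^ i

/-- The `q`-factorial. -/
def qFact (q : ℝ) (n : ℕ) : ℝ :=
  ∏ m ∈ range n, qNum q (m + 1)

/-- The complete homogeneous functions in the specialization of symmetric functions whose
generating series is the `q`-exponential series of `x`; for `0 ≤ q < 1` these are the principal
specialization at the variables `(1 - q) * x * q ^ i`. -/
def completeHomog (x q : ℝ) (n : ℕ) : ℝ :=
  x ^ n * (1 / qFact q n)

/-- The product `q ^ b(λ) / ∏ [h]_q` over the hook lengths `h` of `λ`. -/
def hookWeight (q : ℝ) (lam : YoungDiagram) : ℝ :=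
  q ^ bStat lam * ∏ c ∈ lam.cells, 1 / qNum q (hookLength lam c)

theorem one_sub_mul_qNum (q : ℝ) (k : ℕ) : (1 - q) * qNum q k = 1 - q ^ k :=
  mul_neg_geom_sum q k

theorem pow_mul_qNum_sub (q : ℝ) {a b : ℕ} (hba : b ≤ a) :
    q ^ b * qNum q (a - b) = qNum q a - qNum q b := by
  obtain ⟨d, rfl⟩ := Nat.exists_eq_add_of_le hba
  simp only [qNum, Nat.add_sub_cancel_left, sum_range_add, mul_sum, pow_add]
  ring

theorem qNum_one (k : ℕ) : qNum 1 k = k := by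
  simp [qNum]

theorem qFact_succ (q : ℝ) (n : ℕ) : qFact q (n + 1) = qFact q n * qNum q (n + 1) :=
  prod_range_succ _ _

theorem qFact_one (n : ℕ) : qFact 1 n = n.factorial := by
  simp [qFact, qNum_one, ← prod_range_add_one_eq_factorial]

theorem continuous_qNum (k : ℕ) : Continuous fun q => qNum q k := by
  unfold qNum
  fun_prop

theorem continuous_qFact (n : ℕ) : Continuous fun q => qFact q n :=
  continuous_finsetProd _ fun _ _ => continuous_qNum _

theorem one_le_qNum {q : ℝ} (hq : 0 ≤ q) {k : ℕ} (hk : 0 < k) : 1 ≤ qNum q k := by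
  simpa [qNum] using single_le_sum (f := fun i => q ^ i) (fun i _ => pow_nonneg hq i)
    (mem_range.2 hk)

theorem qNum_pos {q : ℝ} (hq : 0 ≤ q) {k : ℕ} (hk : 0 < k) : 0 < qNum q k :=
  zero_lt_one.trans_le (one_le_qNum hq hk)

theorem one_le_qFact {q : ℝ} (hq : 0 ≤ q) (n : ℕ) : 1 ≤ qFact q n :=
  one_le_prod fun m _ => one_le_qNum hq m.succ_pos

theorem qFact_pos {q : ℝ} (hq : 0 ≤ q) (n : ℕ) : 0 < qFact q n :=
  zero_lt_one.trans_le (one_le_qFact hq n)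

theorem hookWeight_nonneg {q : ℝ} (hq : 0 ≤ q) (lam : YoungDiagram) : 0 ≤ hookWeight q lam :=
  mul_nonneg (pow_nonneg hq _) (prod_nonneg fun _ hc =>
    one_div_nonneg.2 (qNum_pos hq (hookLength_pos hc)).le)

theorem continuousOn_hookWeight (lam : YoungDiagram) :
    ContinuousOn (fun q => hookWeight q lam) (Set.Ici 0) := by
  unfold hookWeight
  refine ContinuousOn.mul (by fun_prop) (continuousOn_finsetProd _ fun c hc => ?_)
  exact continuousOn_const.div (continuous_qNum _).continuousOn fun q hq =>
    (qNum_pos hq (hookLength_pos hc)).ne'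

theorem prod_range_qNum_sub_qNum {q : ℝ} (hq : 0 ≤ q) (l j : ℕ) :
    ∏ k ∈ range j, (qNum q l - qNum q k) =
      qFact q l * (q ^ (∑ k ∈ range j, k) * if j ≤ l then 1 / qFact q (l - j) else 0) := by
  induction j with
  | zero => simp [(qFact_pos hq l).ne']
  | succ j ih =>
    rw [prod_range_succ, ih, sum_range_succ, pow_add]
    rcases lt_trichotomy l j with hlj | rfl | hlj
    · rw [if_neg (by lia), if_neg (by lia)]
      ring
    · simp
    · obtain ⟨d, rfl⟩ := Nat.exists_eq_add_of_lt hlj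
      have hfact := (qFact_pos hq d).ne'
      have hnum := (qNum_pos hq d.succ_pos).ne'
      rw [if_pos (by lia), if_pos (by lia), ← pow_mul_qNum_sub q hlj.le,
        show j + d + 1 - (j + 1) = d by lia, show j + d + 1 - j = d + 1 by lia, qFact_succ q d]
      field_simp

theorem det_vandermonde_eq_prod_Iio {R : Type*} [CommRing R] {N : ℕ} (v : Fin N → R) :
    (Matrix.vandermonde v).det = ∏ a, ∏ b ∈ Iio a, (v a - v b) := by
  rw [Matrix.det_vandermonde]
  exact prod_comm' (by simp)

theorem det_prod_range_sub_eq_det_vandermonde {R : Type*} [CommRing R] {N : ℕ} (v : Fin N → R)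
    (x : ℕ → R) :
    (Matrix.of fun i j : Fin N => ∏ k ∈ range j, (v i - x k)).det =
      (Matrix.vandermonde v).det := by
  rcases subsingleton_or_nontrivial R with _ | _
  · exact Subsingleton.elim _ _
  rw [Matrix.det_eval_matrixOfPolynomials_eq_det_vandermonde v
    fun j => ∏ k ∈ range j, (Polynomial.X - Polynomial.C (x k))]
  · simp only [Polynomial.eval_prod, Polynomial.eval_sub, Polynomial.eval_X, Polynomial.eval_C]
  · intro i
    rw [Polynomial.natDegree_finsetProd_X_sub_C_eq_card, card_range]
  · exact fun i => Polynomial.monic_prod_of_monic _ _ fun k _ => Polynomial.monic_X_sub_C _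

theorem sum_sum_Iio_particlePos {N : ℕ} {lam : YoungDiagram} (hcol : lam.colLen 0 ≤ N) :
    ∑ a : Fin N, ∑ b ∈ Iio a, particlePos N lam b =
      bStat lam + ∑ a : Fin N, ∑ k ∈ range a, k := by
  simp only [particlePos, sum_add_distrib, sum_sum_Iio_rowLen_rev hcol, sum_Iio_val]

theorem prod_qFact_particlePos_eq_hook {N : ℕ} {lam : YoungDiagram} (hcol : lam.colLen 0 ≤ N)
    (q : ℝ) :
    ∏ a, qFact q (particlePos N lam a) =
      (∏ c ∈ lam.cells, qNum q (hookLength lam c)) *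
        ∏ a, ∏ b ∈ Iio a, qNum q (particlePos N lam a - particlePos N lam b) := by
  rw [prod_cells_eq hcol, ← prod_mul_distrib]
  exact prod_congr rfl fun a _ => (prod_row_hookLength_mul_prod_sub hcol (qNum q) a).symm

theorem det_vandermonde_qNum_particlePos {q : ℝ} (hq : 0 ≤ q) {N : ℕ} {lam : YoungDiagram}
    (hcol : lam.colLen 0 ≤ N) :
    (Matrix.vandermonde fun a => qNum q (particlePos N lam a)).det =
      (∏ a, qFact q (particlePos N lam a)) *
        ((∏ a : Fin N, q ^ (∑ k ∈ range a, k)) * hookWeight q lam) := by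
  have hfactor : ∀ a, ∀ b ∈ Iio a, qNum q (particlePos N lam a) - qNum q (particlePos N lam b) =
      q ^ particlePos N lam b * qNum q (particlePos N lam a - particlePos N lam b) :=
    fun a b hb => (pow_mul_qNum_sub q (particlePos_strictMono N lam (mem_Iio.1 hb)).le).symm
  have hne : ∏ c ∈ lam.cells, qNum q (hookLength lam c) ≠ 0 :=
    prod_ne_zero_iff.2 fun c hc => (qNum_pos hq (hookLength_pos hc)).ne'
  rw [det_vandermonde_eq_prod_Iio, prod_congr rfl fun a _ => prod_congr rfl (hfactor a)]
  simp only [prod_mul_distrib, prod_pow_eq_pow_sum]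
  rw [sum_sum_Iio_particlePos hcol, pow_add, prod_qFact_particlePos_eq_hook hcol, hookWeight,
    prod_div_distrib, prod_const_one]
  field_simp

theorem schur_one_div_qFact_of_pos {q : ℝ} (hq : 0 < q) (lam : YoungDiagram) :
    schur (fun n => 1 / qFact q n) lam = hookWeight q lam := by
  set N := lam.colLen 0
  have hfactor := det_prod_range_sub_eq_det_vandermonde
    (fun a => qNum q (particlePos N lam a)) (qNum q)
  simp only [prod_range_qNum_sub_qNum hq.le] at hfactor
  have hrows := Matrix.det_mul_column (fun a => qFact q (particlePos N lam a))
    (Matrix.of fun a j : Fin N => q ^ (∑ k ∈ range (j : ℕ), k) *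
      (jacobiTrudi (fun n => 1 / qFact q n) N).submatrix (particlePos N lam) id a j)
  rw [Matrix.det_mul_row] at hrows
  have hvandermonde := hrows.symm.trans
    (hfactor.trans (det_vandermonde_qNum_particlePos hq.le le_rfl))
  have hfact : ∏ a, qFact q (particlePos N lam a) ≠ 0 :=
    prod_ne_zero_iff.2 fun a _ => (qFact_pos hq.le _).ne'
  have hpow : ∏ a : Fin N, q ^ (∑ k ∈ range (a : ℕ), k) ≠ 0 :=
    prod_ne_zero_iff.2 fun a _ => pow_ne_zero _ hq.ne'
  exact mul_left_cancel₀ hpow (mul_left_cancel₀ hfact hvandermonde)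

theorem continuousOn_schur_one_div_qFact (lam : YoungDiagram) :
    ContinuousOn (fun q => schur (fun n => 1 / qFact q n) lam) (Set.Ici 0) := by
  simp only [schur, Matrix.det_apply]
  refine continuousOn_finsetSum _ fun σ _ => ContinuousOn.const_smul
    (continuousOn_finsetProd _ fun j _ => ?_) _
  simp only [jacobiTrudi, Matrix.submatrix_apply, Matrix.of_apply, id]
  split_ifs
  · exact continuousOn_const.div (continuous_qFact _).continuousOn fun q hq => (qFact_pos hq _).ne'
  · exact continuousOn_const

theorem schur_one_div_qFact {q : ℝ} (hq : 0 ≤ q) (lam : YoungDiagram) :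
    schur (fun n => 1 / qFact q n) lam = hookWeight q lam := by
  have hpos : Set.EqOn (fun q => schur (fun n => 1 / qFact q n) lam) (fun q => hookWeight q lam)
      (Set.Ioi 0) := fun q hq => schur_one_div_qFact_of_pos hq lam
  exact hpos.of_subset_closure (continuousOn_schur_one_div_qFact lam) (continuousOn_hookWeight lam)
    Set.Ioi_subset_Ici_self (by rw [closure_Ioi]) hq

theorem schur_completeHomog {q : ℝ} (hq : 0 ≤ q) (x : ℝ) (lam : YoungDiagram) :
    schur (completeHomog x q) lam = x ^ lam.card * hookWeight q lam := by
  rw [← schur_one_div_qFact hq, ← schur_pow_mul]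
  rfl

theorem continuousOn_schur_completeHomog (x : ℝ) (lam : YoungDiagram) :
    ContinuousOn (fun q => schur (completeHomog x q) lam) (Set.Ici 0) :=
  (continuousOn_const.mul (continuousOn_hookWeight lam)).congr fun _ hq =>
    schur_completeHomog hq x lam

theorem schur_completeHomog_nonneg {x q : ℝ} (hx : 0 ≤ x) (hq : 0 ≤ q) (lam : YoungDiagram) :
    0 ≤ schur (completeHomog x q) lam := by
  rw [schur_completeHomog hq]
  exact mul_nonneg (pow_nonneg hx _) (hookWeight_nonneg hq lam)

theorem completeHomog_zero (x q : ℝ) : completeHomog x q 0 = 1 := by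
  simp [completeHomog, qFact]

theorem schur_completeHomog_div_one_sub {q : ℝ} (hq : 0 ≤ q) (hq1 : q < 1) (s : ℝ)
    (lam : YoungDiagram) : schur (completeHomog (s / (1 - q)) q) lam =
      s ^ lam.card * q ^ bStat lam * ∏ c ∈ lam.cells, 1 / (1 - q ^ hookLength lam c) := by
  have hne : (1 - q) ^ lam.card ≠ 0 := pow_ne_zero _ (sub_ne_zero.2 hq1.ne')
  have hcells : ∏ c ∈ lam.cells, (1 - q ^ hookLength lam c) =
      (1 - q) ^ lam.card * ∏ c ∈ lam.cells, qNum q (hookLength lam c) := by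
    simp only [← one_sub_mul_qNum, prod_mul_distrib, prod_const]
  rw [schur_completeHomog hq, hookWeight, prod_div_distrib, prod_div_distrib, hcells, div_pow]
  field_simp

theorem schur_completeHomog_mul_schur_completeHomog {p q x y x' y' : ℝ} (hp : 0 ≤ p) (hq : 0 ≤ q)
    (hxy : x * y = x' * y') (lam : YoungDiagram) :
    schur (completeHomog x p) lam * schur (completeHomog y q) lam =
      schur (completeHomog x' p) lam * schur (completeHomog y' q) lam := by
  rw [schur_completeHomog hp, schur_completeHomog hq, schur_completeHomog hp,
    schur_completeHomog hq, mul_mul_mul_comm, mul_mul_mul_comm (x' ^ lam.card), ← mul_pow,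
    ← mul_pow, hxy]

end PrincipalSpecialization

section CauchyIdentity

theorem hasSum_of_tendsto_of_le {ι α : Type*} {l : Filter α} [l.NeBot] {f : ι → ℝ}
    {g : α → ι → ℝ} {Z : α → ℝ} {z : ℝ} (hg : ∀ n i, 0 ≤ g n i) (hgf : ∀ n i, g n i ≤ f i)
    (hlim : ∀ i, Tendsto (fun n => g n i) l (𝓝 (f i))) (hsum : ∀ n, HasSum (g n) (Z n))
    (hZ : Tendsto Z l (𝓝 z)) : HasSum f z := by
  refine hasSum_of_isLUB_of_nonneg z (fun i => ge_of_tendsto' (hlim i) fun n => hg n i)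
    ⟨?_, fun B hB => le_of_tendsto' hZ fun n => ?_⟩
  · rintro _ ⟨T, rfl⟩
    exact le_of_tendsto_of_tendsto' (tendsto_finsetSum T fun i _ => hlim i) hZ fun n =>
      sum_le_hasSum T (fun i _ => hg n i) (hsum n)
  · exact hasSum_le_of_sum_le (hsum n) fun T =>
      (sum_le_sum fun i _ => hgf n i).trans (hB (Set.mem_range_self T))

theorem hasSum_of_tendsto_sum_of_nonneg {ι : Type*} {f : ι → ℝ} (hf : ∀ i, 0 ≤ f i)
    {s : ℕ → Finset ι} (hs : ∀ i, f i ≠ 0 → ∀ᶠ n in atTop, i ∈ s n) {z : ℝ}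
    (hz : Tendsto (fun n => ∑ i ∈ s n, f i) atTop (𝓝 z)) : HasSum f z := by
  classical
  refine hasSum_of_tendsto_of_le (g := fun n i => if i ∈ s n then f i else 0)
    (fun n i => ?_) (fun n i => ?_) (fun i => ?_) (fun n => ?_) hz
  · split_ifs
    exacts [hf i, le_rfl]
  · split_ifs
    exacts [le_rfl, hf i]
  · rcases eq_or_ne (f i) 0 with hi | hi
    · simp [hi]
    · refine tendsto_const_nhds.congr' ?_
      filter_upwards [hs i hi] with n hn
      rw [if_pos hn]
  · rw [← sum_filter_of_ne (p := (· ∈ s n)) fun i hi _ => hi, sum_filter]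
    exact hasSum_sum_of_ne_finset_zero fun i hi => if_neg hi

variable {R : Type*} [CommRing R]

/-- The infinite alternant of the variables `x`, with a row for each exponent. -/
def alternant {N : ℕ} (x : Fin N → R) : Matrix ℕ (Fin N) R :=
  Matrix.of fun l i => x i ^ l

theorem hasSum_jacobiTrudi_mul_pow [TopologicalSpace R] [IsTopologicalRing R] {h : ℕ → R}
    {x F : R} (hF : HasSum (fun n => h n * x ^ n) F) {N : ℕ} (j : Fin N) :
    HasSum (fun l => jacobiTrudi h N l j * x ^ l) (F * x ^ (j : ℕ)) := by
  refine ((add_left_injective (j : ℕ)).hasSum_iff fun l hl => ?_).1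
    ((hF.mul_right (x ^ (j : ℕ))).congr_fun fun n => ?_)
  · have hlj : ¬ (j : ℕ) ≤ l := fun hjl => hl ⟨l - j, Nat.sub_add_cancel hjl⟩
    simp [jacobiTrudi, hlj]
  · simp [jacobiTrudi, pow_add, mul_assoc]

theorem tendsto_sum_partitionBox_schur_mul_det_alternant [TopologicalSpace R]
    [IsTopologicalRing R] {h : ℕ → R} (h0 : h 0 = 1) {N : ℕ} {x F : Fin N → R}
    (hF : ∀ i, HasSum (fun n => h n * x i ^ n) (F i)) :
    Tendsto (fun L => ∑ lam ∈ partitionBox N L,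
        schur h lam * ((alternant x).submatrix (particlePos N lam) id).det)
      atTop (𝓝 ((Matrix.vandermonde x).det * ∏ i, F i)) := by
  have hdet : (Matrix.of fun j i => F i * (Matrix.vandermonde x)ᵀ j i).det =
      (Matrix.vandermonde x).det * ∏ i, F i := by
    rw [Matrix.det_mul_row, Matrix.det_transpose, mul_comm]
  have hgram : ∀ L, ∑ lam ∈ partitionBox N L,
      schur h lam * ((alternant x).submatrix (particlePos N lam) id).det =
      ((firstRows L (jacobiTrudi h N))ᵀ * firstRows L (alternant x)).det := fun L => by
    rw [← sum_partitionBox_det_mul_det]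
    refine sum_congr rfl fun lam hlam => ?_
    rw [schur_eq_det h0 (mem_partitionBox.1 hlam).1]
  simp only [hgram, ← hdet]
  refine ((continuous_id.matrix_det).tendsto _).comp
    (tendsto_pi_nhds.2 fun j => tendsto_pi_nhds.2 fun i => ?_)
  refine (hasSum_jacobiTrudi_mul_pow (hF i) j).tendsto_sum_nat.congr fun L => ?_
  exact sum_range fun l => jacobiTrudi h N l j * x i ^ l

/-- The product by which the Schur functions of the variables `1, q, …, q ^ (N - 1)` differ from
those of the infinite geometric progression. The exponent is `N` plus the content of the cell; it
is truncated only for diagrams with more than `N` rows, whose product already has a zero factor. -/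
def contentProduct (q : ℝ) (N : ℕ) (lam : YoungDiagram) : ℝ :=
  ∏ c ∈ lam.cells, (1 - q ^ (N + c.2 - c.1))

theorem contentProduct_nonneg {q : ℝ} (hq : 0 ≤ q) (hq1 : q ≤ 1) (N : ℕ) (lam : YoungDiagram) :
    0 ≤ contentProduct q N lam :=
  prod_nonneg fun _ _ => sub_nonneg.2 (pow_le_one₀ hq hq1)

theorem contentProduct_le_one {q : ℝ} (hq : 0 ≤ q) (hq1 : q ≤ 1) (N : ℕ) (lam : YoungDiagram) :
    contentProduct q N lam ≤ 1 :=
  prod_le_one (fun _ _ => sub_nonneg.2 (pow_le_one₀ hq hq1))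
    fun _ _ => sub_le_self _ (pow_nonneg hq _)

theorem contentProduct_eq_zero (q : ℝ) {N : ℕ} {lam : YoungDiagram} (hN : N < lam.colLen 0) :
    contentProduct q N lam = 0 :=
  prod_eq_zero (i := (N, 0)) ((YoungDiagram.mem_cells _).2 (YoungDiagram.mem_iff_lt_colLen.2 hN))
    (by simp)

theorem contentProduct_zero_one {lam : YoungDiagram} (hcol : lam.colLen 0 ≤ 1) :
    contentProduct 0 1 lam = 1 := by
  refine (prod_cells_eq hcol _).trans (prod_eq_one fun a _ => prod_eq_one fun j _ => ?_)
  simp [add_comm 1 j]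

theorem tendsto_contentProduct {q : ℝ} (hq : 0 ≤ q) (hq1 : q < 1) (lam : YoungDiagram) :
    Tendsto (fun N => contentProduct q N lam) atTop (𝓝 1) := by
  have hlim : Tendsto (fun N => contentProduct q N lam) atTop
      (𝓝 (∏ c ∈ lam.cells, (1 - 0))) := by
    refine tendsto_finsetProd _ fun c _ => tendsto_const_nhds.sub ?_
    refine (tendsto_pow_atTop_nhds_zero_of_lt_one hq hq1).comp ?_
    exact tendsto_atTop_mono (fun N => by omega) (tendsto_sub_atTop_nat c.1)
  simpa using hlim

theorem one_sub_pow_card_mul_prod_qFact_particlePos (q : ℝ) {N : ℕ} {lam : YoungDiagram}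
    (hcol : lam.colLen 0 ≤ N) :
    (1 - q) ^ lam.card * ∏ a, qFact q (particlePos N lam a) =
      contentProduct q N lam * ∏ a : Fin N, qFact q a := by
  have hfact : ∀ a : Fin N, qFact q (particlePos N lam a) =
      qFact q a * ∏ j ∈ range (lam.rowLen a.rev), qNum q (a + j + 1) := fun a => by
    rw [particlePos, add_comm, qFact, prod_range_add, qFact]
  have hcontent : contentProduct q N lam =
      ∏ a : Fin N, ∏ j ∈ range (lam.rowLen a.rev), (1 - q) * qNum q (a + j + 1) := by
    refine (prod_cells_eq hcol _).trans
      (prod_congr rfl fun a _ => prod_congr rfl fun j _ => ?_)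
    rw [one_sub_mul_qNum, show N + j - (a.rev : ℕ) = a + j + 1 by rw [Fin.val_rev]; omega]
  have hcard : (1 - q) ^ lam.card = ∏ a : Fin N, ∏ j ∈ range (lam.rowLen a.rev), (1 - q) := by
    rw [← prod_cells_eq hcol fun _ => 1 - q, prod_const]
  simp only [hfact, hcontent, hcard, prod_mul_distrib]
  ring

theorem hookWeight_bot (q : ℝ) : hookWeight q ⊥ = 1 := by
  simp [hookWeight, bStat, colLen_zero_bot]

theorem particlePos_bot {N : ℕ} (a : Fin N) : particlePos N ⊥ a = a := by
  rw [particlePos, rowLen_eq_zero_iff.2 (colLen_zero_bot.trans_le (Nat.zero_le _)), zero_add]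

theorem det_vandermonde_pow_eq (q : ℝ) {N : ℕ} (s : Fin N → ℕ) :
    (Matrix.vandermonde fun a => q ^ s a).det =
      (∏ a : Fin N, ∏ _b ∈ Iio a, (q - 1)) * (Matrix.vandermonde fun a => qNum q (s a)).det := by
  simp only [det_vandermonde_eq_prod_Iio, ← prod_mul_distrib]
  refine prod_congr rfl fun a _ => prod_congr rfl fun b _ => ?_
  linear_combination one_sub_mul_qNum q (s a) - one_sub_mul_qNum q (s b)

theorem det_alternant_pow_eq_mul_schur {q : ℝ} (hq : 0 ≤ q) (hq1 : q < 1) {N : ℕ}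
    {lam : YoungDiagram} (hcol : lam.colLen 0 ≤ N) :
    ((alternant fun i : Fin N => q ^ (i : ℕ)).submatrix (particlePos N lam) id).det =
      (Matrix.vandermonde fun i : Fin N => q ^ (i : ℕ)).det *
        (schur (completeHomog (1 / (1 - q)) q) lam * contentProduct q N lam) := by
  have halternant : (alternant fun i : Fin N => q ^ (i : ℕ)).submatrix (particlePos N lam) id =
      Matrix.vandermonde fun a => q ^ particlePos N lam a := by
    ext a i
    exact pow_right_comm q _ _
  have hempty := det_vandermonde_qNum_particlePos (lam := ⊥) hq
    (colLen_zero_bot.trans_le N.zero_le)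
  simp only [particlePos_bot, hookWeight_bot, mul_one] at hempty
  have hfact := one_sub_pow_card_mul_prod_qFact_particlePos q hcol
  have hne : (1 - q) ^ lam.card ≠ 0 := pow_ne_zero _ (sub_ne_zero.2 hq1.ne')
  rw [halternant, det_vandermonde_pow_eq, det_vandermonde_pow_eq, hempty,
    det_vandermonde_qNum_particlePos hq hcol, schur_completeHomog hq, one_div_pow]
  field_simp
  linear_combination (∏ a : Fin N, ∏ _b ∈ Iio a, (q - 1)) *
    (∏ a : Fin N, q ^ ∑ k ∈ range a, k) * hookWeight q lam * hfact

theorem hasSum_schur_principal_mul_contentProduct_mul_schur {q : ℝ} (hq : 0 ≤ q) (hq1 : q < 1)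
    {N : ℕ} (hne : (Matrix.vandermonde fun i : Fin N => q ^ (i : ℕ)).det ≠ 0) {h : ℕ → ℝ}
    (h0 : h 0 = 1) (hnonneg : ∀ lam, 0 ≤ schur h lam) {F : Fin N → ℝ}
    (hF : ∀ i : Fin N, HasSum (fun n => h n * (q ^ (i : ℕ)) ^ n) (F i)) :
    HasSum (fun lam => schur (completeHomog (1 / (1 - q)) q) lam * contentProduct q N lam *
      schur h lam) (∏ i, F i) := by
  refine hasSum_of_tendsto_sum_of_nonneg (s := partitionBox N) (fun lam => ?_)
    (fun lam hlam => ?_) ?_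
  · exact mul_nonneg (mul_nonneg (schur_completeHomog_nonneg
      (one_div_nonneg.2 (sub_nonneg.2 hq1.le)) hq lam) (contentProduct_nonneg hq hq1.le N lam))
      (hnonneg lam)
  · have hcol : lam.colLen 0 ≤ N := not_lt.1 fun hN => hlam (by
      rw [contentProduct_eq_zero q hN, mul_zero, zero_mul])
    filter_upwards [eventually_ge_atTop (lam.rowLen 0 + N)] with L hL
    exact mem_partitionBox.2 ⟨hcol, hL⟩
  · have hcauchy := (tendsto_sum_partitionBox_schur_mul_det_alternant h0
      hF).const_mul (Matrix.vandermonde fun i : Fin N => q ^ (i : ℕ)).det⁻¹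
    rw [inv_mul_cancel_left₀ hne] at hcauchy
    refine hcauchy.congr fun L => ?_
    rw [mul_sum]
    refine sum_congr rfl fun lam hlam => ?_
    rw [det_alternant_pow_eq_mul_schur hq hq1 (mem_partitionBox.1 hlam).1]
    field_simp

theorem hookWeight_zero_eq_zero {lam : YoungDiagram} (hcol : 1 < lam.colLen 0) :
    hookWeight 0 lam = 0 := by
  have hrow : 0 < lam.rowLen 1 := Nat.pos_of_ne_zero (mt rowLen_eq_zero_iff.1 hcol.not_ge)
  have hb : bStat lam ≠ 0 := fun hzero =>
    (Nat.mul_pos one_pos hrow).ne' (sum_eq_zero_iff.1 hzero 1 (mem_range.2 hcol))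
  rw [hookWeight, zero_pow hb, zero_mul]

theorem hasSum_schur_principal_zero_mul_schur {h : ℕ → ℝ} (h0 : h 0 = 1)
    (hnonneg : ∀ lam, 0 ≤ schur h lam) {Z : ℝ} (hZ : HasSum h Z) :
    HasSum (fun lam => schur (completeHomog (1 / (1 - 0)) 0) lam * schur h lam) Z := by
  have hone := hasSum_schur_principal_mul_contentProduct_mul_schur (N := 1) (F := fun _ => Z)
    le_rfl zero_lt_one (by simp) h0 hnonneg (by simpa using hZ)
  rw [prod_const, card_univ, Fintype.card_fin, pow_one] at hone
  refine hone.congr_fun fun lam => ?_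
  rcases le_or_gt (lam.colLen 0) 1 with hcol | hcol
  · rw [contentProduct_zero_one hcol, mul_one]
  · simp only [schur_completeHomog le_rfl, hookWeight_zero_eq_zero hcol, mul_zero, zero_mul]

theorem hasSum_schur_principal_mul_schur {q : ℝ} (hq : 0 ≤ q) (hq1 : q < 1) {h : ℕ → ℝ}
    (h0 : h 0 = 1) (hnonneg : ∀ lam, 0 ≤ schur h lam) {F : ℕ → ℝ}
    (hF : ∀ i, HasSum (fun n => h n * (q ^ i) ^ n) (F i)) {Z : ℝ}
    (hZ : Tendsto (fun N => ∏ i ∈ range N, F i) atTop (𝓝 Z)) :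
    HasSum (fun lam => schur (completeHomog (1 / (1 - q)) q) lam * schur h lam) Z := by
  rcases hq.eq_or_lt with rfl | hq0
  · have hF1 : ∀ i, F (i + 1) = 1 := fun i => by
      refine (hF (i + 1)).unique ?_
      simpa [h0] using hasSum_single (f := fun n => h n * ((0 : ℝ) ^ (i + 1)) ^ n) 0
        fun n hn => by simp [hn]
    have hZ0 : F 0 = Z := tendsto_nhds_unique
      (tendsto_const_nhds.congr fun N => by simp [prod_range_succ', hF1])
      (hZ.comp (tendsto_add_atTop_nat 1))
    exact hasSum_schur_principal_zero_mul_schur h0 hnonneg (by simpa [hZ0] using hF 0)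
  have hnonneg' : ∀ lam, 0 ≤ schur (completeHomog (1 / (1 - q)) q) lam := fun lam =>
    schur_completeHomog_nonneg (one_div_nonneg.2 (sub_nonneg.2 hq1.le)) hq lam
  have hne : ∀ N, (Matrix.vandermonde fun i : Fin N => q ^ (i : ℕ)).det ≠ 0 := fun N =>
    Matrix.det_vandermonde_ne_zero_iff.2 fun a b hab => Fin.ext
      (pow_right_injective₀ hq0 hq1.ne hab)
  simp only [prod_range] at hZ
  refine hasSum_of_tendsto_of_le (fun N lam => mul_nonneg (mul_nonneg (hnonneg' lam)
    (contentProduct_nonneg hq hq1.le N lam)) (hnonneg lam)) (fun N lam => ?_) (fun lam => ?_)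
    (fun N => hasSum_schur_principal_mul_contentProduct_mul_schur hq hq1 (hne N) h0 hnonneg
      fun i => hF i) hZ
  · exact mul_le_mul_of_nonneg_right (mul_le_of_le_one_right (hnonneg' lam)
      (contentProduct_le_one hq hq1.le N lam)) (hnonneg lam)
  · simpa only [mul_one] using
      ((tendsto_contentProduct hq hq1 lam).const_mul _).mul_const (schur h lam)

end CauchyIdentity

section NormalizingConstants

variable {q w : ℝ}

/-- The `q`-exponential series. -/
def qExp (q w : ℝ) : ℝ :=
  ∑' n, completeHomog w q n

theorem completeHomog_nonneg (hq : 0 ≤ q) (hw : 0 ≤ w) (n : ℕ) : 0 ≤ completeHomog w q n :=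
  mul_nonneg (pow_nonneg hw n) (one_div_nonneg.2 (qFact_pos hq n).le)

theorem completeHomog_mul (w r q : ℝ) (n : ℕ) :
    completeHomog (w * r) q n = completeHomog w q n * r ^ n := by
  rw [completeHomog, completeHomog, mul_pow, mul_right_comm]

theorem completeHomog_succ_mul (hq : 0 ≤ q) (w : ℝ) (n : ℕ) :
    completeHomog w q (n + 1) * (1 - q ^ (n + 1)) = w * (1 - q) * completeHomog w q n := by
  have hfact := (qFact_pos hq n).ne'
  have hnum := (qNum_pos hq n.succ_pos).ne'
  rw [completeHomog, completeHomog, qFact_succ, ← one_sub_mul_qNum]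
  field_simp
  ring

theorem summable_completeHomog (hq : 0 ≤ q) (hq1 : q < 1) (hw : 0 ≤ w) (hwq : w * (1 - q) < 1) :
    Summable (completeHomog w q) := by
  obtain ⟨r, hwr, hr⟩ := exists_between hwq
  have hlim : Tendsto (fun n : ℕ => r * (1 - q ^ (n + 1))) atTop (𝓝 (r * (1 - 0))) :=
    (((tendsto_pow_atTop_nhds_zero_of_lt_one hq hq1).comp (tendsto_add_atTop_nat 1)).const_sub
      1).const_mul r
  rw [sub_zero, mul_one] at hlim
  refine summable_of_ratio_norm_eventually_le hr ?_
  filter_upwards [hlim.eventually_const_lt hwr] with n hn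
  rw [Real.norm_of_nonneg (completeHomog_nonneg hq hw _),
    Real.norm_of_nonneg (completeHomog_nonneg hq hw _)]
  refine le_of_mul_le_mul_right ?_ (sub_pos.2 (pow_lt_one₀ hq hq1 n.succ_ne_zero))
  rw [completeHomog_succ_mul hq, mul_right_comm r]
  exact mul_le_mul_of_nonneg_right hn.le (completeHomog_nonneg hq hw n)

theorem mul_pow_mul_one_sub_lt_one (hq : 0 ≤ q) (hq1 : q < 1) (hw : 0 ≤ w)
    (hwq : w * (1 - q) < 1) (i : ℕ) : w * q ^ i * (1 - q) < 1 := by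
  rw [mul_right_comm]
  exact (mul_le_of_le_one_right (mul_nonneg hw (sub_nonneg.2 hq1.le))
    (pow_le_one₀ hq hq1.le)).trans_lt hwq

theorem hasSum_qExp_mul_pow (hq : 0 ≤ q) (hq1 : q < 1) (hw : 0 ≤ w) (hwq : w * (1 - q) < 1)
    (i : ℕ) : HasSum (fun n => completeHomog w q n * (q ^ i) ^ n) (qExp q (w * q ^ i)) :=
  (summable_completeHomog hq hq1 (mul_nonneg hw (pow_nonneg hq i))
    (mul_pow_mul_one_sub_lt_one hq hq1 hw hwq i)).hasSum.congr_fun fun n =>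
      (completeHomog_mul w (q ^ i) q n).symm

theorem qExp_mul_one_sub (hq : 0 ≤ q) (hq1 : q < 1) (hw : 0 ≤ w) (hwq : w * (1 - q) < 1) :
    qExp q w * (1 - w * (1 - q)) = qExp q (w * q) := by
  have hsum : HasSum (completeHomog w q) (qExp q w) :=
    (summable_completeHomog hq hq1 hw hwq).hasSum
  have hsumq := hasSum_qExp_mul_pow hq hq1 hw hwq 1
  have hshift : HasSum (fun n => completeHomog w q n - completeHomog w q n * (q ^ 1) ^ n)
      (w * (1 - q) * qExp q w) := by
    refine (hasSum_nat_add_iff' 1).1 ?_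
    simp only [range_one, sum_singleton, pow_zero, mul_one, sub_self, sub_zero, pow_one]
    refine (hsum.mul_left (w * (1 - q))).congr_fun fun n => ?_
    rw [← completeHomog_succ_mul hq, mul_sub, mul_one]
  have hdiff := (hsum.sub hsumq).unique hshift
  rw [pow_one] at hdiff
  linear_combination hdiff

theorem one_le_qExp (hq : 0 ≤ q) (hq1 : q < 1) (hw : 0 ≤ w) (hwq : w * (1 - q) < 1) :
    1 ≤ qExp q w := by
  rw [← completeHomog_zero w q]
  exact (summable_completeHomog hq hq1 hw hwq).le_tsum 0 fun n _ => completeHomog_nonneg hq hw n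

theorem qExp_mul_pow_le (hq : 0 ≤ q) (hq1 : q < 1) (hw : 0 ≤ w) (hwq : w * (1 - q) < 1)
    (i : ℕ) : qExp q (w * q ^ i) ≤ 1 + qExp q w * q ^ i := by
  have hsum := hasSum_qExp_mul_pow hq hq1 hw hwq i
  have hbound := (hasSum_ite_eq 0 (1 : ℝ)).add
    ((summable_completeHomog hq hq1 hw hwq).hasSum.mul_right (q ^ i))
  refine hasSum_le (fun n => ?_) hsum hbound
  have hnonneg := completeHomog_nonneg hq hw n
  rcases eq_or_ne n 0 with rfl | hn
  · simpa [completeHomog_zero] using pow_nonneg hq i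
  · rw [if_neg hn, zero_add]
    exact mul_le_mul_of_nonneg_left
      (pow_le_of_le_one (pow_nonneg hq i) (pow_le_one₀ hq hq1.le) hn) hnonneg

theorem tendsto_qExp_mul_pow_pow (hq : 0 ≤ q) (hq1 : q < 1) (hw : 0 ≤ w)
    (hwq : w * (1 - q) < 1) : Tendsto (fun N : ℕ => qExp q (w * q ^ N) ^ N) atTop (𝓝 1) := by
  have hupper : Tendsto (fun N : ℕ => (1 + qExp q w * q ^ N) ^ N) atTop (𝓝 1) := by
    simpa only [Real.exp_zero] using Real.tendsto_one_add_pow_exp_of_tendsto (t := 0)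
      (by simpa only [mul_zero, mul_left_comm] using
        (tendsto_self_mul_const_pow_of_lt_one hq hq1).const_mul (qExp q w))
  have hone : ∀ N : ℕ, 1 ≤ qExp q (w * q ^ N) := fun N =>
    one_le_qExp hq hq1 (mul_nonneg hw (pow_nonneg hq N))
      (mul_pow_mul_one_sub_lt_one hq hq1 hw hwq N)
  exact tendsto_of_tendsto_of_tendsto_of_le_of_le tendsto_const_nhds hupper
    (fun N => one_le_pow₀ (hone N)) fun N =>
      pow_le_pow_left₀ (zero_le_one.trans (hone N)) (qExp_mul_pow_le hq hq1 hw hwq N) N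

theorem prod_range_mul_prod_range_pow {M : Type*} [CommMonoid M] {e u : ℕ → M}
    (heu : ∀ n, e n * u n = e (n + 1)) (N : ℕ) :
    (∏ i ∈ range N, e i) * ∏ n ∈ range N, u n ^ (n + 1) = e N ^ N := by
  induction N with
  | zero => simp
  | succ N ih =>
    rw [prod_range_succ, prod_range_succ, mul_mul_mul_comm, ih, pow_succ (u N), ← heu N,
      mul_pow, pow_succ (e N), pow_succ (u N)]
    simp only [mul_assoc, mul_comm, mul_left_comm]

theorem one_sub_mul_pow_pos {t : ℝ} (hq : 0 ≤ q) (hq1 : q < 1) (ht : 0 ≤ t) (ht1 : t < 1)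
    (n : ℕ) : 0 < 1 - t * q ^ n :=
  sub_pos.2 ((mul_le_of_le_one_right ht (pow_le_one₀ hq hq1.le)).trans_lt ht1)

theorem neg_log_one_sub_mul_pow_le {t : ℝ} (hq : 0 ≤ q) (hq1 : q < 1) (ht : 0 ≤ t) (ht1 : t < 1)
    (n : ℕ) : -Real.log (1 - t * q ^ n) ≤ (1 - t)⁻¹ * q ^ n := by
  have hpos := one_sub_mul_pow_pos hq hq1 ht ht1 n
  have htq : t * q ^ n ≤ t := mul_le_of_le_one_right ht (pow_le_one₀ hq hq1.le)
  calc -Real.log (1 - t * q ^ n) ≤ (1 - t * q ^ n)⁻¹ - 1 := by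
        linarith [Real.one_sub_inv_le_log_of_pos hpos]
    _ = (1 - t * q ^ n)⁻¹ * (t * q ^ n) := by
        field_simp
        ring
    _ ≤ (1 - t)⁻¹ * q ^ n := by
        refine mul_le_mul (inv_anti₀ (sub_pos.2 ht1) (by linarith))
          (mul_le_of_le_one_left (pow_nonneg hq n) ht1.le) (by positivity)
          (inv_nonneg.2 (sub_nonneg.2 ht1.le))

theorem multipliable_one_div_one_sub_mul_pow_pow {t : ℝ} (hq : 0 ≤ q) (hq1 : q < 1)
    (ht : 0 ≤ t) (ht1 : t < 1) :
    Multipliable fun n : ℕ => 1 / (1 - t * q ^ n) ^ (n + 1) := by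
  have hpos := one_sub_mul_pow_pos hq hq1 ht ht1
  have hlog : ∀ n : ℕ, Real.log (1 / (1 - t * q ^ n) ^ (n + 1)) =
      ((n : ℝ) + 1) * -Real.log (1 - t * q ^ n) := fun n => by
    rw [one_div, Real.log_inv, Real.log_pow, Nat.cast_succ, mul_neg]
  have hbound : Summable fun n : ℕ => ((n : ℝ) + 1) * ((1 - t)⁻¹ * q ^ n) := by
    have hgeom : Summable fun n : ℕ => (n : ℝ) ^ 1 * q ^ n :=
      summable_pow_mul_geometric_of_norm_lt_one 1 (by rwa [Real.norm_of_nonneg hq])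
    refine ((hgeom.add (summable_geometric_of_lt_one hq hq1)).mul_left (1 - t)⁻¹).congr
      fun n => ?_
    ring
  refine Real.multipliable_of_summable_log (fun n => one_div_pos.2 (pow_pos (hpos n) _)) ?_
  simp only [hlog]
  refine Summable.of_nonneg_of_le (fun n => mul_nonneg (by positivity) (neg_nonneg.2 ?_))
    (fun n => mul_le_mul_of_nonneg_left (neg_log_one_sub_mul_pow_le hq hq1 ht ht1 n)
      (by positivity)) hbound
  exact Real.log_nonpos (hpos n).le (sub_le_self _ (mul_nonneg ht (pow_nonneg hq n)))

theorem tendsto_prod_qExp (hq : 0 ≤ q) (hq1 : q < 1) (hw : 0 ≤ w) (hwq : w * (1 - q) < 1) :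
    Tendsto (fun N => ∏ i ∈ range N, qExp q (w * q ^ i)) atTop
      (𝓝 (∏' n : ℕ, 1 / (1 - w * (1 - q) * q ^ n) ^ (n + 1))) := by
  have ht : 0 ≤ w * (1 - q) := mul_nonneg hw (sub_nonneg.2 hq1.le)
  have hstep : ∀ n, qExp q (w * q ^ n) * (1 - w * (1 - q) * q ^ n) = qExp q (w * q ^ (n + 1)) :=
    fun n => by
      rw [pow_succ, ← mul_assoc, ← qExp_mul_one_sub hq hq1 (mul_nonneg hw (pow_nonneg hq n))
        (mul_pow_mul_one_sub_lt_one hq hq1 hw hwq n), mul_right_comm w]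
  have hlim := (tendsto_qExp_mul_pow_pow hq hq1 hw hwq).mul
    (multipliable_one_div_one_sub_mul_pow_pow hq hq1 ht hwq).tendsto_prod_tprod_nat
  rw [one_mul] at hlim
  refine hlim.congr fun N => ?_
  have hne : ∏ n ∈ range N, (1 - w * (1 - q) * q ^ n) ^ (n + 1) ≠ 0 :=
    prod_ne_zero_iff.2 fun n _ => pow_ne_zero _ (one_sub_mul_pow_pos hq hq1 ht hwq n).ne'
  rw [← prod_range_mul_prod_range_pow hstep, prod_div_distrib, prod_const_one,
    mul_assoc, mul_one_div_cancel hne, mul_one]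

theorem hasSum_schur_principal_mul_schur_principal {t : ℝ} (hq : 0 ≤ q) (hq1 : q < 1)
    (ht : 0 ≤ t) (ht1 : t < 1) :
    HasSum (fun lam => schur (completeHomog (1 / (1 - q)) q) lam *
      schur (completeHomog (t / (1 - q)) q) lam)
      (∏' n : ℕ, 1 / (1 - t * q ^ n) ^ (n + 1)) := by
  have hwq : t / (1 - q) * (1 - q) = t := div_mul_cancel₀ t (sub_pos.2 hq1).ne'
  have hw : 0 ≤ t / (1 - q) := div_nonneg ht (sub_nonneg.2 hq1.le)
  have hprod := tendsto_prod_qExp hq hq1 hw (hwq.trans_lt ht1)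
  rw [hwq] at hprod
  exact hasSum_schur_principal_mul_schur hq hq1 (completeHomog_zero _ q)
    (schur_completeHomog_nonneg hw hq)
    (hasSum_qExp_mul_pow hq hq1 hw (hwq.trans_lt ht1)) hprod

theorem hasSum_completeHomog_one (x : ℝ) : HasSum (completeHomog x 1) (Real.exp x) := by
  rw [Real.exp_eq_exp_ℝ]
  refine (NormedSpace.expSeries_div_hasSum_exp x).congr_fun fun n => ?_
  rw [completeHomog, qFact_one, mul_one_div]

theorem hasSum_schur_principal_mul_schur_plancherel {z : ℝ} (hq : 0 ≤ q) (hq1 : q < 1)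
    (hz : 0 ≤ z) :
    HasSum (fun lam => schur (completeHomog (1 / (1 - q)) q) lam *
      schur (completeHomog z 1) lam) (Real.exp (z / (1 - q))) := by
  refine hasSum_schur_principal_mul_schur (F := fun i => Real.exp (z * q ^ i)) hq hq1
    (completeHomog_zero z 1) (schur_completeHomog_nonneg hz zero_le_one)
    (fun i => (hasSum_completeHomog_one (z * q ^ i)).congr_fun fun n =>
      (completeHomog_mul z (q ^ i) 1 n).symm) ?_
  simp only [← Real.exp_sum, ← mul_sum, div_eq_mul_inv]
  exact (Real.continuous_exp.tendsto _).comp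
    ((hasSum_geometric_of_lt_one hq hq1).tendsto_sum_nat.const_mul z)

end NormalizingConstants

section QPlancherelMeasures

variable {q : ℝ}

theorem hasSum_sq_schur_principal {s : ℝ} (hq : 0 ≤ q) (hq1 : q < 1) (hs : s ^ 2 < 1) :
    HasSum (fun lam => schur (completeHomog (s / (1 - q)) q) lam ^ 2)
      (∏' n : ℕ, 1 / (1 - s ^ 2 * q ^ n) ^ (n + 1)) := by
  refine (hasSum_schur_principal_mul_schur_principal hq hq1 (sq_nonneg s) hs).congr_fun
    fun lam => ?_
  rw [pow_two]
  refine schur_completeHomog_mul_schur_completeHomog hq hq ?_ lam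
  rw [div_mul_div_comm, div_mul_div_comm, one_mul, pow_two]

theorem sum_schur_mul_schur_plancherel_le (hq : 0 ≤ q) (hq1 : q < 1) (y : ℝ)
    (T : Finset YoungDiagram) :
    ∑ lam ∈ T, schur (completeHomog y q) lam * schur (completeHomog y 1) lam ≤
      Real.exp (y ^ 2) := by
  have hpos : 0 < 1 - q := sub_pos.2 hq1
  have hz : 0 ≤ y ^ 2 * (1 - q) := mul_nonneg (sq_nonneg y) hpos.le
  have hsum := hasSum_schur_principal_mul_schur_plancherel hq hq1 hz
  rw [mul_div_cancel_right₀ _ hpos.ne'] at hsum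
  calc ∑ lam ∈ T, schur (completeHomog y q) lam * schur (completeHomog y 1) lam
      = ∑ lam ∈ T, schur (completeHomog (1 / (1 - q)) q) lam *
          schur (completeHomog (y ^ 2 * (1 - q)) 1) lam :=
        sum_congr rfl fun lam _ =>
          schur_completeHomog_mul_schur_completeHomog hq zero_le_one (by field_simp) lam
    _ ≤ Real.exp (y ^ 2) := sum_le_hasSum T (fun lam _ => mul_nonneg
        (schur_completeHomog_nonneg (one_div_nonneg.2 hpos.le) hq lam)
        (schur_completeHomog_nonneg hz zero_le_one lam)) hsum

-- The bound on the mixed sums is uniform in `q`, so it survives the limit `q → 1`.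
theorem summable_sq_schur_plancherel (y : ℝ) :
    Summable fun lam => schur (completeHomog y 1) lam ^ 2 := by
  refine summable_of_sum_le (c := Real.exp (y ^ 2)) (fun lam => sq_nonneg _) fun T => ?_
  have hlim : Tendsto
      (fun q => ∑ lam ∈ T, schur (completeHomog y q) lam * schur (completeHomog y 1) lam)
      (𝓝[<] 1) (𝓝 (∑ lam ∈ T, schur (completeHomog y 1) lam ^ 2)) := by
    simp only [pow_two]
    refine tendsto_finsetSum _ fun lam _ => Tendsto.mul_const _ ?_
    exact ((continuousOn_schur_completeHomog y lam).continuousAt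
      (Ici_mem_nhds zero_lt_one)).tendsto.mono_left nhdsWithin_le_nhds
  refine le_of_tendsto hlim ?_
  filter_upwards [Ico_mem_nhdsLT zero_lt_one] with q hq
  exact sum_schur_mul_schur_plancherel_le hq.1 hq.2 y T

theorem squaredWeight_eq (hq : 0 ≤ q) (hq1 : q < 1) (ξ : ℝ) :
    squaredWeight ξ q = fun lam => (∏' n : ℕ, 1 / (1 - √(ξ ^ 2 * q) ^ 2 * q ^ n) ^ (n + 1))⁻¹ *
      (schur (completeHomog (√(ξ ^ 2 * q) / (1 - q)) q) lam *
        schur (completeHomog (√(ξ ^ 2 * q) / (1 - q)) q) lam) := by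
  funext lam
  have hsq : √(ξ ^ 2 * q) ^ 2 = ξ ^ 2 * q := Real.sq_sqrt (mul_nonneg (sq_nonneg ξ) hq)
  have hmacMahon : modMacMahon ξ q =
      ∏' n : ℕ, 1 / (1 - √(ξ ^ 2 * q) ^ 2 * q ^ n) ^ (n + 1) := by
    simp only [modMacMahon, hsq, pow_succ' q, mul_assoc]
  rw [schur_completeHomog_div_one_sub hq hq1, squaredWeight, hmacMahon]
  nth_rw 2 [← hsq]
  simp only [← one_div_pow, prod_pow]
  ring

theorem mixedWeight_eq (hq : 0 ≤ q) (hq1 : q < 1) (ξ : ℝ) :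
    mixedWeight ξ q = fun lam => (Real.exp (ξ ^ 2 / (1 - q)))⁻¹ *
      (schur (completeHomog (1 / (1 - q)) q) lam * schur (completeHomog (ξ ^ 2) 1) lam) := by
  funext lam
  rw [schur_completeHomog_div_one_sub hq hq1, schur_completeHomog zero_le_one, hookWeight,
    mixedWeight, Real.exp_neg]
  simp only [qNum_one, ← one_div_mul_one_div, prod_mul_distrib]
  ring

theorem isProbabilityMeasure_and_isDiscreteDeterminantal_squaredQPlancherel {ξ : ℝ}
    (hq : 0 ≤ q) (hq1 : q < 1) (hξ : ξ ^ 2 * q < 1) :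
    IsProbabilityMeasure (squaredQPlancherel ξ q) ∧
      IsDiscreteDeterminantal (configurationLaw (squaredQPlancherel ξ q)) := by
  have hs : √(ξ ^ 2 * q) ^ 2 < 1 := by rwa [Real.sq_sqrt (mul_nonneg (sq_nonneg ξ) hq)]
  have hsum := hasSum_sq_schur_principal hq hq1 hs
  rw [squaredQPlancherel, squaredWeight_eq hq hq1]
  exact isProbabilityMeasure_and_isDiscreteDeterminantal_schurMeasure (completeHomog_zero _ q)
    (completeHomog_zero _ q)
    (fun lam => mul_self_nonneg _) (hsum.congr_fun fun lam => (pow_two _).symm)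
    hsum.summable hsum.summable

theorem isProbabilityMeasure_and_isDiscreteDeterminantal_mixedQPlancherel (hq : 0 ≤ q)
    (hq1 : q < 1) (ξ : ℝ) :
    IsProbabilityMeasure (mixedQPlancherel ξ q) ∧
      IsDiscreteDeterminantal (configurationLaw (mixedQPlancherel ξ q)) := by
  -- Only the product of the two parameters matters: halving the principal one makes its Schur
  -- functions square summable.
  have hrescale := schur_completeHomog_mul_schur_completeHomog (p := q) (q := 1) hq zero_le_one
    (show 1 / (1 - q) * ξ ^ 2 = 1 / 2 / (1 - q) * (2 * ξ ^ 2) by ring)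
  have hsum := hasSum_schur_principal_mul_schur_plancherel hq hq1 (sq_nonneg ξ)
  have hx : 0 ≤ 1 / 2 / (1 - q) := div_nonneg one_half_pos.le (sub_nonneg.2 hq1.le)
  have hy : 0 ≤ 2 * ξ ^ 2 := mul_nonneg zero_le_two (sq_nonneg ξ)
  simp only [hrescale] at hsum
  rw [mixedQPlancherel, mixedWeight_eq hq hq1]
  simp only [hrescale]
  exact isProbabilityMeasure_and_isDiscreteDeterminantal_schurMeasure (completeHomog_zero _ q)
    (completeHomog_zero _ 1)
    (fun lam => mul_nonneg (schur_completeHomog_nonneg hx hq lam)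
      (schur_completeHomog_nonneg hy zero_le_one lam)) hsum
    (hasSum_sq_schur_principal hq hq1 (by norm_num)).summable (summable_sq_schur_plancherel _)

theorem corollary2_general (q ξ : ℝ) (hq : q ∈ Set.Ico (0 : ℝ) 1) :
    (ξ ^ 2 * q < 1 → IsProbabilityMeasure (squaredQPlancherel ξ q) ∧
      IsDiscreteDeterminantal (configurationLaw (squaredQPlancherel ξ q))) ∧
    IsProbabilityMeasure (mixedQPlancherel ξ q) ∧
      IsDiscreteDeterminantal (configurationLaw (mixedQPlancherel ξ q)) :=
  ⟨isProbabilityMeasure_and_isDiscreteDeterminantal_squaredQPlancherel hq.1 hq.2,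
    isProbabilityMeasure_and_isDiscreteDeterminantal_mixedQPlancherel hq.1 hq.2 ξ⟩

end QPlancherelMeasures

end

theorem corollary2 (q ξ : ℝ) (hq : q ∈ Set.Ico (0 : ℝ) 1) (hξ : ξ ∈ Set.Ico (0 : ℝ) 1) :
    IsProbabilityMeasure (squaredQPlancherel ξ q) ∧
    IsProbabilityMeasure (mixedQPlancherel ξ q) ∧
    IsDiscreteDeterminantal (configurationLaw (squaredQPlancherel ξ q)) ∧
    IsDiscreteDeterminantal (configurationLaw (mixedQPlancherel ξ q)) := by
  obtain ⟨hsquared, hprobMixed, hdetMixed⟩ := corollary2_general q ξ hq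
  obtain ⟨hprobSquared, hdetSquared⟩ :=
    hsquared (mul_lt_one_of_nonneg_of_lt_one_left (sq_nonneg ξ)
      (pow_lt_one₀ hξ.1 hξ.2 two_ne_zero) hq.2.le)
  exact ⟨hprobSquared, hprobMixed, hdetSquared, hdetMixed⟩
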